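/- Let $L$ be a finite tree and let $(v_1,\dots,v_r)$, $r\ge 1$, be a path in $L$ (the spine; the $v_i$ are the spinal vertices) such that every vertex of $L$ is at distance at most $2$ from some $v_i$; that is, $L$ is a lobster with this spine. For each $i$, the lobe $F_i$ at $v_i$ is the connected component containing $v_i$ of the graph obtained from $L$ by deleting the spine edges $v_jv_{j+1}$, $1\le j\le r-1$. A pendant vertex at $v_i$ is a vertex whose only neighbour in $F_i$ is $v_i$, and the reduced lobe $F_i'$ is obtained from $F_i$ by deleting all pendant vertices at $v_i$. The lobster is called pairwise similar if $F_i'\cong F_{i+1}'$ as graphs for every odd $i\in\{1,\dots,r-1\}$, and the spinal vertex $v_i$ is called essentially odd if the degree of $v_i$ in $F_i'$ is odd. If $L$ is pairwise similar and all of its spinal vertices $v_1,\dots,v_r$ are essentially odd, then $L$ is graceful: writing $m$ for the number of edges of $L$, there is an injective map $f:V(L)\to\{0,1,\dots,m\}$ such that the numbers $|f(u)-f(v)|$, over all edges $uv$ of $L$, are pairwise distinct. -/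

import Mathlib

namespace LobsterGraph

/-- A graceful labeling of a graph with `m` edges: an injective vertex labeling with values in
`{0, 1, …, m}` such that the induced edge labels `|f u - f v|` are pairwise distinct. -/
structure IsGracefulLabeling {V : Type*} (G : SimpleGraph V) (f : V → ℕ) : Prop where
  le_card : ∀ x, f x ≤ G.edgeSet.ncard
  injective : Function.Injective f
  edge_distinct : ∀ x y z w, G.Adj x y → G.Adj z w →
    |(f x : ℤ) - (f y : ℤ)| = |(f z : ℤ) - (f w : ℤ)| → s(x, y) = s(z, w)

/-- A graph is graceful if it has a graceful labeling. -/
def IsGraceful {V : Type*} (G : SimpleGraph V) : Prop :=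
  ∃ f : V → ℕ, IsGracefulLabeling G f

/-- `G` is a lobster with spine `p`: `G` is a tree, `p` is a path in it, and every vertex is
within distance two of some vertex of `p`. The spinal vertices `v_1, …, v_r` are
`p.getVert 0, …, p.getVert p.length`, so `r = p.length + 1`. -/
structure IsLobsterWithSpine {V : Type*} (G : SimpleGraph V) {a b : V} (p : G.Walk a b) :
    Prop where
  isTree : G.IsTree
  isPath : p.IsPath
  dist_le : ∀ x, ∃ s ∈ p.support, G.dist s x ≤ 2

variable {V : Type*} {G : SimpleGraph V} {a b : V}

/-- The lobe at the spinal vertex `p.getVert i`: the part of `G` that is still connected to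
this vertex after the edges of the spine are deleted. -/
def lobe (p : G.Walk a b) (i : ℕ) : G.Subgraph :=
  (⊤ : G.Subgraph).induce {x | (G.deleteEdges {e | e ∈ p.edges}).Reachable (p.getVert i) x}

/-- The pendant vertices at `p.getVert i`: the vertices whose only neighbour in the lobe is
this spinal vertex. -/
def pendants (p : G.Walk a b) (i : ℕ) : Set V :=
  {u | (lobe p i).neighborSet u = {p.getVert i}}

/-- The reduced lobe: the lobe with all pendant vertices at the spinal vertex deleted. -/
def reducedLobe (p : G.Walk a b) (i : ℕ) : G.Subgraph :=
  (lobe p i).deleteVerts (pendants p i)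

/-- The reduced lobes at `v_j` and `v_{j+1}` are isomorphic graphs for every odd
`j ∈ {1, …, r - 1}`; here `j = i + 1` with `i` even, because `p.getVert` counts from zero. -/
def PairwiseSimilar (p : G.Walk a b) : Prop :=
  ∀ i, Even i → i + 1 ≤ p.length →
    Nonempty ((reducedLobe p i).coe ≃g (reducedLobe p (i + 1)).coe)

/-- The spinal vertex `p.getVert i` has odd degree in its reduced lobe. -/
def EssentiallyOdd (p : G.Walk a b) (i : ℕ) : Prop :=
  Odd ((reducedLobe p i).neighborSet (p.getVert i)).ncard

end LobsterGraph

namespace LobsterGraph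

/-! The proof combines a graceful labeling of one reduced lobe with a doubling trick.

A reduced lobe is a rooted tree of height two whose root has an odd number `d = 2h + 1` of children
(branches), each with at least one leaf; let `n` be the number of leaves and `M = d + n`. Give the
root the label 0 and the branches the zigzag `M, 1, M - 1, 2, …`, so the root edges repeat the
branch labels. The labels `h + 1, …, h + n` are left for the leaves. If all leaves hung on the
branch labelled `M`, their edge labels would be exactly the missing `h + 1, …, h + n`. Leaves are
then passed along the zigzag: since `|u - x| = |v - (u + v - x)|`, a set invariant under `x ↦ u + v
- x` can move from `u` to `v` without changing its edge labels (`HasDistribution.transfer`). Each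
branch keeps its own number of leaves and hands on the rest; this works if the branches with an odd
number of leaves come first (`hasDistribution_Ico`). Oddness of `d` is what centres the interval of
leaf labels correctly.

The spine is treated from its far end, two lobes at a time
(`IsLobsterShape.exists_isTailLabeling_pair`). Two equal reduced lobes receive the same labeling,
one with its branches raised by a constant `H`, the other with its root and leaves raised by `H`.
Their edge labels are then `H + D` and `H - D`, around the label `H` of the spine edge joining them,
and the labeling of the remaining lobes fits in between. Pendant vertices fill intervals of labels.
An unpaired last lobe uses the labeling of one lobe directly.

It remains to encode a lobster by a parent map and to show that isomorphic reduced lobes have the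
same leaf counts, although an isomorphism need not preserve the spinal vertex
(`IsBranchNumbering.transport`). -/

/-! ### Distributing leaves along a zigzag. -/

/-- The sequence `u, v, u - 1, v + 1, u - 2, v + 2, …`. -/
def zigzag : ℕ → ℤ → ℤ → ℤ
  | 0, u, _ => u
  -- Negation exchanges the rising and the falling end, so one kind of step serves all inductions on
  -- the zigzag.
  | t + 1, u, v => -zigzag t (-v) (1 - u)

theorem zigzag_two_mul (i : ℕ) : ∀ u v, zigzag (2 * i) u v = u - i := by
  induction i with
  | zero => intro u v; simp [zigzag]
  | succ i ih =>
    intro u v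
    rw [show 2 * (i + 1) = 2 * i + 1 + 1 by ring, zigzag, zigzag, ih]
    push_cast; ring

theorem zigzag_two_mul_add_one (i : ℕ) (u v : ℤ) : zigzag (2 * i + 1) u v = v + i := by
  rw [zigzag, zigzag_two_mul]; ring

/-- The values `g t j`, for `t < d` and `j < K t`, are pairwise distinct. -/
def InjOnPairs (d : ℕ) (K : ℕ → ℕ) (g : ℕ → ℕ → ℤ) : Prop :=
  ∀ s t i j, s < d → t < d → i < K s → j < K t → g s i = g t j → s = t ∧ i = j

/-- The elements of `S` can be attached as leaves to the first `d` vertices of the zigzag, with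
`K t` of them at the vertex `t`, so that the edge labels are those of the star with centre `u`
and set of leaves `S`. -/
def HasDistribution (d : ℕ) (K : ℕ → ℕ) (u v : ℤ) (S : Finset ℤ) : Prop :=
  ∃ g y : ℕ → ℕ → ℤ, InjOnPairs d K g ∧ InjOnPairs d K y ∧ ∀ t j, t < d → j < K t →
    g t j ∈ S ∧ y t j ∈ S ∧ |zigzag t u v - g t j| = |u - y t j|

theorem exists_enumeration {α : Type*} [Nonempty α] (T : Finset α) :
    ∃ g : ℕ → α, (∀ j < T.card, g j ∈ T) ∧
      ∀ i < T.card, ∀ j < T.card, g i = g j → i = j := by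
  classical
  refine ⟨fun j => if h : j < T.card then T.equivFin.symm ⟨j, h⟩ else Classical.arbitrary α,
    ?_, ?_⟩
  · intro j hj
    simp [hj]
  · intro i hi j hj h
    simpa [hi, hj, Subtype.coe_inj] using h

/-- Moving the part `S'` of the leaves at `u` to `v` does not change the edge labels if `S'` is
invariant under `x ↦ u + v - x`. -/
theorem HasDistribution.transfer {d : ℕ} {K : ℕ → ℕ} {u v : ℤ} {S S' : Finset ℤ}
    (hS : S' ⊆ S) (hsymm : ∀ x ∈ S', u + v - x ∈ S') (hcard : S.card = S'.card + K 0)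
    (h : HasDistribution d (fun t => K (t + 1)) (-v) (1 - u) (S'.image Neg.neg)) :
    HasDistribution (d + 1) K u v S := by
  classical
  obtain ⟨g, y, hg, hy, hgy⟩ := h
  have hc : (S \ S').card = K 0 := by
    rw [Finset.card_sdiff_of_subset hS]; omega
  obtain ⟨e, he, hinj⟩ := exists_enumeration (S \ S')
  rw [hc] at he hinj
  have hmem : ∀ t j, t < d → j < K (t + 1) → -g t j ∈ S' ∧ -y t j ∈ S' := by
    intro t j ht hj
    obtain ⟨h1, h2, -⟩ := hgy t j ht hj
    rw [Finset.mem_image] at h1 h2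
    obtain ⟨x, hx, hx'⟩ := h1
    obtain ⟨z, hz, hz'⟩ := h2
    rw [← hx', ← hz']
    simpa using ⟨hx, hz⟩
  -- The vertex 0 keeps `S \ S'`. For the others, `y` lists leaves of the star at `-v`; the
  -- reflection `x ↦ u + v - x` of `-y` is the leaf of the star at `u` with the same edge label.
  refine ⟨fun t j => match t with | 0 => e j | t + 1 => -g t j,
    fun t j => match t with | 0 => e j | t + 1 => u + v + y t j, ?_, ?_, ?_⟩
  · rintro (_ | s) (_ | t) i j hs ht hi hj heq
    · exact ⟨rfl, hinj i hi j hj heq⟩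
    · have h1 := he i hi
      have h2 := (hmem t j (by omega) hj).1
      simp only at heq
      rw [← heq] at h2
      simp_all
    · have h1 := he j hj
      have h2 := (hmem s i (by omega) hi).1
      simp only at heq
      rw [heq] at h2
      simp_all
    · have := hg s t i j (by omega) (by omega) hi hj (by simpa using heq)
      omega
  · have key : ∀ t j, t < d → j < K (t + 1) → u + v + y t j ∈ S' := by
      intro t j ht hj
      have := hsymm _ (hmem t j ht hj).2
      rwa [sub_neg_eq_add] at this
    rintro (_ | s) (_ | t) i j hs ht hi hj heq
    · exact ⟨rfl, hinj i hi j hj heq⟩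
    · have h1 := he i hi
      have h2 := key t j (by omega) hj
      simp only at heq
      rw [← heq] at h2
      simp_all
    · have h1 := he j hj
      have h2 := key s i (by omega) hi
      simp only at heq
      rw [heq] at h2
      simp_all
    · have := hy s t i j (by omega) (by omega) hi hj (by simpa using heq)
      omega
  · rintro (_ | t) j ht hj
    · have := he j hj
      rw [Finset.mem_sdiff] at this
      exact ⟨this.1, this.1, rfl⟩
    · have h1 := hmem t j (by omega) hj
      refine ⟨hS h1.1, hS ?_, ?_⟩
      · have := hsymm _ h1.2
        rwa [sub_neg_eq_add] at this
      · have h3 := (hgy t j (by omega) hj).2.2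
        simp only [zigzag]
        rw [show -zigzag t (-v) (1 - u) - -g t j = -(zigzag t (-v) (1 - u) - g t j) by ring,
          abs_neg, h3]
        congr 1
        ring

theorem hasDistribution_zero (K : ℕ → ℕ) (u v : ℤ) (S : Finset ℤ) :
    HasDistribution 0 K u v S :=
  ⟨fun _ _ => 0, fun _ _ => 0, fun _ _ _ _ h => absurd h (by omega),
    fun _ _ _ _ h => absurd h (by omega), fun _ _ h => absurd h (by omega)⟩

/-- Distribution of two blocks of equal length, if all the numbers of leaves are even. -/
theorem hasDistribution_of_even (d : ℕ) : ∀ (K : ℕ → ℕ) (u v a c : ℤ) (n : ℕ),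
    (∀ t < d, Even (K t) ∧ 0 < K t) → 2 * n = ∑ t ∈ Finset.range d, K t →
    a + c + n = u + v → a + n ≤ c →
    HasDistribution d K u v (Finset.Ico a (a + n) ∪ Finset.Ico c (c + n)) := by
  classical
  induction d with
  | zero => intros; exact hasDistribution_zero ..
  | succ d ih =>
    intro K u v a c n hK hn hsum hac
    obtain ⟨⟨s, hs⟩, hpos⟩ := hK 0 (by omega)
    rw [Finset.sum_range_succ'] at hn
    obtain ⟨r, rfl⟩ : ∃ r, n = r + s := ⟨n - s, by omega⟩
    have hcard : ∀ (a c : ℤ) (n : ℕ), a + n ≤ c →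
        (Finset.Ico a (a + n) ∪ Finset.Ico c (c + n)).card = 2 * n := by
      intro a c n h
      rw [Finset.card_union_of_disjoint]
      · simp; omega
      · rw [Finset.disjoint_left]
        intro x
        simp only [Finset.mem_Ico]
        omega
    push_cast at *
    -- The first block loses its `s` smallest elements; the second loses `c` and its `s - 1`
    -- largest, which requires `0 < s`. Removing `c` makes the rest symmetric and widens the gap
    -- between the blocks.
    refine HasDistribution.transfer
      (S' := Finset.Ico (a + s) (a + s + r) ∪ Finset.Ico (c + 1) (c + 1 + r)) ?_ ?_ ?_ ?_
    · intro x
      simp only [Finset.mem_union, Finset.mem_Ico]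
      omega
    · intro x
      simp only [Finset.mem_union, Finset.mem_Ico]
      omega
    · rw [hcard _ _ _ (by omega)]
      have := hcard a c (r + s) (by push_cast; omega)
      push_cast at this
      rw [this]; omega
    · have := ih (fun t => K (t + 1)) (-v) (1 - u) (-(c + r)) (1 - a - s - r) r
        (fun t ht => hK (t + 1) (by omega)) (by omega) (by omega) (by omega)
      convert this using 1
      ext x
      simp only [Finset.mem_union, Finset.mem_Ico, Finset.mem_image]
      constructor
      · rintro ⟨y, hy, rfl⟩; omega
      · intro hx; exact ⟨-x, by omega, by omega⟩

/-- Distribution of an interval, if the odd numbers of leaves come first. -/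
theorem hasDistribution_Ico (d : ℕ) : ∀ (K : ℕ → ℕ) (u v a : ℤ) (n : ℕ),
    (∀ t < d, 0 < K t) → (∀ s t, s ≤ t → t < d → Odd (K t) → Odd (K s)) →
    n = ∑ t ∈ Finset.range d, K t → 2 * a + n = u + v →
    HasDistribution d K u v (Finset.Ico a (a + n)) := by
  classical
  induction d with
  | zero => intros; exact hasDistribution_zero ..
  | succ d ih =>
    intro K u v a n hK hodd hn hsum
    by_cases h0 : Odd (K 0)
    · obtain ⟨s, hs⟩ := h0
      rw [Finset.sum_range_succ'] at hn
      obtain ⟨r, rfl⟩ : ∃ r, n = r + (2 * s + 1) := ⟨n - (2 * s + 1), by omega⟩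
      push_cast at *
      -- The endpoints of the interval add up to `u + v - 1`, and a symmetric interval needs `u +
      -- v`. Hence one more element is dropped below than above, an odd number in total.
      refine HasDistribution.transfer
        (S' := Finset.Ico (a + s + 1) (a + s + 1 + r)) ?_ ?_ ?_ ?_
      · intro x
        simp only [Finset.mem_Ico]
        omega
      · intro x
        simp only [Finset.mem_Ico]
        omega
      · simp only [Int.card_Ico]
        omega
      · have := ih (fun t => K (t + 1)) (-v) (1 - u) (-(a + s + r)) r
          (fun t ht => hK (t + 1) (by omega))
          (fun s t hst ht => hodd (s + 1) (t + 1) (by omega) (by omega)) (by omega) (by omega)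
        convert this using 1
        ext x
        simp only [Finset.mem_Ico, Finset.mem_image]
        constructor
        · rintro ⟨y, hy, rfl⟩; omega
        · intro hx; exact ⟨-x, by omega, by omega⟩
    · have heven : ∀ t < d + 1, Even (K t) := by
        intro t ht
        by_contra h
        exact h0 (hodd 0 t (by omega) ht (Nat.not_even_iff_odd.1 h))
      obtain ⟨m, hm⟩ : Even (∑ t ∈ Finset.range (d + 1), K t) :=
        Finset.even_sum _ fun t ht => heven t (Finset.mem_range.1 ht)
      -- From here on all numbers of leaves are even, so the interval is cut into two adjacent
      -- blocks of length `m`.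
      obtain rfl : n = m + m := by omega
      have := hasDistribution_of_even (d + 1) K u v a (a + m) m
        (fun t ht => ⟨heven t ht, hK t ht⟩) (by omega) (by push_cast at hsum; omega) le_rfl
      convert this using 1
      ext x
      simp only [Finset.mem_union, Finset.mem_Ico]
      push_cast
      omega

/-! ### Graceful labelings of a single reduced lobe. -/

/-- A graceful labeling, with label `0` at the root, of the rooted tree of height two whose root
has `d` children, the `t`-th of which has `K t` children: `U` labels the children of the root and
`g` the leaves. -/
structure IsLobeLabeling (d : ℕ) (K : ℕ → ℕ) (M : ℕ) (U : ℕ → ℤ) (g : ℕ → ℕ → ℤ) : Prop where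
  branch_mem : ∀ t < d, 1 ≤ U t ∧ U t ≤ M
  branch_inj : ∀ s < d, ∀ t < d, U s = U t → s = t
  leaf_mem : ∀ t j, t < d → j < K t → 1 ≤ g t j ∧ g t j ≤ M
  leaf_inj : InjOnPairs d K g
  leaf_ne : ∀ s t j, s < d → t < d → j < K t → g t j ≠ U s
  edge_inj : InjOnPairs d K fun t j => |U t - g t j|
  edge_ne : ∀ s t j, s < d → t < d → j < K t → |U t - g t j| ≠ U s
  edge_mem : ∀ t j, t < d → j < K t → 1 ≤ |U t - g t j| ∧ |U t - g t j| ≤ M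

/-- The branches take the labels `1, …, h` and `h + n + 1, …, d + n`, both as vertices and as edges
to the root; the interval in between serves the leaves and their edges. -/
theorem exists_isLobeLabeling {d : ℕ} (hd : Odd d) {K : ℕ → ℕ} (hK : ∀ t < d, 0 < K t)
    (hodd : ∀ s t, s ≤ t → t < d → Odd (K t) → Odd (K s)) :
    ∃ U g, IsLobeLabeling d K (d + ∑ t ∈ Finset.range d, K t) U g := by
  obtain ⟨h, rfl⟩ := hd
  set d := 2 * h + 1 with hd
  set n := ∑ t ∈ Finset.range d, K t with hn
  -- The centring condition reads `2 * (h + 1) + n = (d + n) + 1`, that is, `d = 2 * h + 1`.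
  obtain ⟨g, y, hg, hy, hgy⟩ := hasDistribution_Ico d K (d + n) 1 (h + 1) n hK hodd hn
    (by push_cast [hd]; ring)
  have hU : ∀ t < d, ∃ i : ℕ, (t = 2 * i ∧ i ≤ h ∧ zigzag t (d + n) 1 = d + n - i) ∨
      (t = 2 * i + 1 ∧ i + 1 ≤ h ∧ zigzag t (d + n) 1 = 1 + i) := by
    intro t ht
    rcases Nat.even_or_odd' t with ⟨i, rfl | rfl⟩
    · exact ⟨i, Or.inl ⟨rfl, by omega, zigzag_two_mul ..⟩⟩
    · exact ⟨i, Or.inr ⟨rfl, by omega, zigzag_two_mul_add_one ..⟩⟩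
  have hE : ∀ t j, t < d → j < K t → (h + 1 ≤ g t j ∧ g t j < h + 1 + n) ∧
      (h + 1 ≤ y t j ∧ y t j < h + 1 + n) ∧
      |zigzag t (d + n) 1 - g t j| = d + n - y t j := by
    intro t j ht hj
    obtain ⟨h1, h2, h3⟩ := hgy t j ht hj
    rw [Finset.mem_Ico] at h1 h2
    refine ⟨h1, h2, h3.trans (abs_of_nonneg ?_)⟩
    omega
  refine ⟨fun t => zigzag t (d + n) 1, g, ⟨?_, ?_, ?_, hg, ?_, ?_, ?_, ?_⟩⟩
  · intro t ht
    obtain ⟨i, hi⟩ := hU t ht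
    push_cast
    omega
  · intro s hs t ht heq
    obtain ⟨i, hi⟩ := hU s hs
    obtain ⟨j, hj⟩ := hU t ht
    omega
  · intro t j ht hj
    have := hE t j ht hj
    push_cast
    omega
  · intro s t j hs ht hj
    obtain ⟨i, hi⟩ := hU s hs
    have := hE t j ht hj
    omega
  · intro s t i j hs ht hi hj heq
    have h1 := hE s i hs hi
    have h2 := hE t j ht hj
    simp only at heq
    exact hy s t i j hs ht hi hj (by omega)
  · intro s t j hs ht hj
    obtain ⟨i, hi⟩ := hU s hs
    have := hE t j ht hj
    omega
  · intro t j ht hj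
    have := hE t j ht hj
    push_cast
    omega

/-! ### Lobsters as parent maps, and labelings built from the far end of the spine. -/

/-- A lobster given by its parent map: the spine is `v 0, …, v n`, every vertex `x` belongs to
the lobe at `v (idx x)`, and `lvl x` is `0` for a spinal vertex, `1` for a neighbour of a spinal
vertex in a reduced lobe, `2` for a vertex at distance two from the spine and `3` for a
pendant vertex. -/
structure IsLobsterShape {V : Type*} (n : ℕ) (v : ℕ → V) (idx lvl : V → ℕ) (par : V → V) :
    Prop where
  idx_le : ∀ x, idx x ≤ n
  lvl_le : ∀ x, lvl x ≤ 3
  eq_spine : ∀ x, lvl x = 0 → x = v (idx x)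
  lvl_spine : ∀ i ≤ n, lvl (v i) = 0
  idx_spine : ∀ i ≤ n, idx (v i) = i
  par_spine : ∀ i < n, par (v (i + 1)) = v i
  par_branch : ∀ x, lvl x = 1 → par x = v (idx x)
  par_pendant : ∀ x, lvl x = 3 → par x = v (idx x)
  lvl_par : ∀ x, lvl x = 2 → lvl (par x) = 1
  idx_par : ∀ x, lvl x = 2 → idx (par x) = idx x

/-- A numbering `c` of the vertices of the lobe `i`: the `d` neighbours of the spinal vertex in
the reduced lobe, the `K t` leaves at the `t`-th of them, and the `P` pendant vertices. -/
structure IsLobeCoding {V : Type*} [Fintype V] (idx lvl : V → ℕ) (par : V → V) (i d : ℕ)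
    (K : ℕ → ℕ) (P : ℕ) (c : V → ℕ) : Prop where
  branch_lt : ∀ x, idx x = i → lvl x = 1 → c x < d
  branch_inj : ∀ x y, idx x = i → lvl x = 1 → idx y = i → lvl y = 1 → c x = c y → x = y
  leaf_lt : ∀ x, idx x = i → lvl x = 2 → c x < K (c (par x))
  leaf_inj : ∀ x y, idx x = i → lvl x = 2 → idx y = i → lvl y = 2 → par x = par y →
    c x = c y → x = y
  pendant_lt : ∀ x, idx x = i → lvl x = 3 → c x < P
  pendant_inj : ∀ x y, idx x = i → lvl x = 3 → idx y = i → lvl y = 3 → c x = c y → x = y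
  card_eq : (Finset.univ.filter fun x => idx x = i).card =
    1 + d + ∑ t ∈ Finset.range d, K t + P

/-- A graceful labeling of the lobes from `i` on, with label `0` at `v i`. -/
structure IsTailLabeling {V : Type*} [Fintype V] (n : ℕ) (v : ℕ → V) (idx : V → ℕ)
    (par : V → V) (i : ℕ) (f : V → ℤ) : Prop where
  nonneg : ∀ x, i ≤ idx x → 0 ≤ f x
  lt_card : ∀ x, i ≤ idx x → f x < (Finset.univ.filter fun x => i ≤ idx x).card
  inj : ∀ x y, i ≤ idx x → i ≤ idx y → f x = f y → x = y
  root : i ≤ n → f (v i) = 0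
  edge_lt : ∀ x, i ≤ idx x → x ≠ v i →
    |f x - f (par x)| < (Finset.univ.filter fun x => i ≤ idx x).card
  edge_inj : ∀ x y, i ≤ idx x → i ≤ idx y → x ≠ v i → y ≠ v i →
    |f x - f (par x)| = |f y - f (par y)| → x = y

section

variable {V : Type*} [Fintype V] {n : ℕ} {v : ℕ → V} {idx lvl : V → ℕ} {par : V → V}

/-- Since the root has label 0, pendant vertices labelled `M + 1, M + 2, …` contribute edges with
the same labels, beyond all those of the reduced lobe. -/
theorem IsLobsterShape.exists_isTailLabeling_last (hs : IsLobsterShape n v idx lvl par)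
    {d : ℕ} {K : ℕ → ℕ} {P : ℕ} {c : V → ℕ} (hc : IsLobeCoding idx lvl par n d K P c)
    {U : ℕ → ℤ} {g : ℕ → ℕ → ℤ}
    (hl : IsLobeLabeling d K (d + ∑ t ∈ Finset.range d, K t) U g) :
    ∃ f, IsTailLabeling n v idx par n f := by
  classical
  set M := d + ∑ t ∈ Finset.range d, K t with hM
  have hcard : ((Finset.univ.filter fun x => n ≤ idx x).card : ℤ) = M + 1 + P := by
    have : (Finset.univ.filter fun x => n ≤ idx x) = Finset.univ.filter fun x => idx x = n := by
      ext x
      have := hs.idx_le x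
      simp only [Finset.mem_filter, Finset.mem_univ, true_and]
      omega
    rw [this, hc.card_eq]
    push_cast [hM]; ring
  have hidx : ∀ x, n ≤ idx x → idx x = n := fun x h => le_antisymm (hs.idx_le x) h
  let f : V → ℤ := fun x => if lvl x = 0 then 0 else if lvl x = 1 then U (c x) else
    if lvl x = 2 then g (c (par x)) (c x) else M + 1 + c x
  have hroot : f (v n) = 0 := by simp [f, hs.lvl_spine]
  have hcls : ∀ x, n ≤ idx x →
      (x = v n ∧ f x = 0) ∨
      (lvl x = 1 ∧ c x < d ∧ (1 ≤ U (c x) ∧ U (c x) ≤ M) ∧ f x = U (c x) ∧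
        |f x - f (par x)| = U (c x)) ∨
      (lvl x = 2 ∧ c (par x) < d ∧ c x < K (c (par x)) ∧
        (1 ≤ g (c (par x)) (c x) ∧ g (c (par x)) (c x) ≤ M) ∧
        f x = g (c (par x)) (c x) ∧
        |f x - f (par x)| = |U (c (par x)) - g (c (par x)) (c x)| ∧
        |f x - f (par x)| ≤ M) ∨
      (lvl x = 3 ∧ c x < P ∧ f x = M + 1 + c x ∧ |f x - f (par x)| = M + 1 + c x) := by
    intro x hx
    have hx' := hidx x hx
    have h3 := hs.lvl_le x
    have h4 : lvl x = 0 ∨ lvl x = 1 ∨ lvl x = 2 ∨ lvl x = 3 := by omega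
    rcases h4 with h | h | h | h
    · refine Or.inl ⟨?_, by simp [f, h]⟩
      rw [hs.eq_spine x h, hx']
    · have h1 := hc.branch_lt x hx' h
      have h2 := hl.branch_mem _ h1
      have h5 : f x = U (c x) := by simp [f, h]
      refine Or.inr (Or.inl ⟨h, h1, h2, h5, ?_⟩)
      rw [hs.par_branch x h, hx', hroot, h5, sub_zero, abs_of_nonneg (by omega)]
    · have h1 := hc.leaf_lt x hx' h
      have h0 := hc.branch_lt (par x) ((hs.idx_par x h).trans hx') (hs.lvl_par x h)
      have h5 : f x = g (c (par x)) (c x) := by simp [f, h]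
      have h6 : f (par x) = U (c (par x)) := by simp [f, hs.lvl_par x h]
      have h7 : |f x - f (par x)| = |U (c (par x)) - g (c (par x)) (c x)| := by
        rw [h5, h6, abs_sub_comm]
      exact Or.inr (Or.inr (Or.inl ⟨h, h0, h1, hl.leaf_mem _ _ h0 h1, h5, h7,
        h7 ▸ (hl.edge_mem _ _ h0 h1).2⟩))
    · have h1 := hc.pendant_lt x hx' h
      have h5 : f x = M + 1 + c x := by simp [f, h]
      refine Or.inr (Or.inr (Or.inr ⟨h, h1, h5, ?_⟩))
      rw [hs.par_pendant x h, hx', hroot, h5, sub_zero, abs_of_nonneg (by omega)]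
  refine ⟨f, ⟨?_, ?_, ?_, fun _ => hroot, ?_, ?_⟩⟩
  · intro x hx
    rcases hcls x hx with h | h | h | h <;> omega
  · intro x hx
    rw [hcard]
    rcases hcls x hx with h | h | h | h <;> omega
  · intro x y hx hy heq
    have hx' := hidx x hx
    have hy' := hidx y hy
    rcases hcls x hx with h | ⟨h1, h2, h3, h4, -⟩ | ⟨h1, h2, h3, h4, h5, -⟩ | ⟨h1, h2, h3, -⟩ <;>
    rcases hcls y hy with k | ⟨k1, k2, k3, k4, -⟩ | ⟨k1, k2, k3, k4, k5, -⟩ | ⟨k1, k2, k3, -⟩ <;>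
    first
    | (exfalso; omega)
    | exact h.1.trans k.1.symm
    | exact hc.branch_inj x y hx' h1 hy' k1 (hl.branch_inj _ h2 _ k2 (by omega))
    | exact hc.pendant_inj x y hx' h1 hy' k1 (by omega)
    | exact absurd (by omega) (hl.leaf_ne _ _ _ h2 k2 k3)
    | exact absurd (by omega) (hl.leaf_ne _ _ _ k2 h2 h3)
    | (obtain ⟨e1, e2⟩ := hl.leaf_inj _ _ _ _ h2 k2 h3 k3 (by omega)
       exact hc.leaf_inj x y hx' h1 hy' k1 (hc.branch_inj _ _ ((hs.idx_par x h1).trans hx')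
        (hs.lvl_par x h1) ((hs.idx_par y k1).trans hy') (hs.lvl_par y k1) e1) e2)
  · intro x hx hne
    rw [hcard]
    rcases hcls x hx with h | h | h | h
    · exact absurd h.1 hne
    all_goals omega
  · intro x y hx hy hnx hny heq
    have hx' := hidx x hx
    have hy' := hidx y hy
    rcases hcls x hx with h | ⟨h1, h2, h3, -, h4⟩ | ⟨h1, h2, h3, -, -, h5, h6⟩ |
      ⟨h1, h2, -, h3⟩ <;>
    rcases hcls y hy with k | ⟨k1, k2, k3, -, k4⟩ | ⟨k1, k2, k3, -, -, k5, k6⟩ |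
      ⟨k1, k2, -, k3⟩ <;>
    first
    | exact absurd h.1 hnx
    | exact absurd k.1 hny
    | (exfalso; omega)
    | exact hc.branch_inj x y hx' h1 hy' k1 (hl.branch_inj _ h2 _ k2 (by omega))
    | exact hc.pendant_inj x y hx' h1 hy' k1 (by omega)
    | exact absurd (by omega) (hl.edge_ne _ _ _ h2 k2 k3)
    | exact absurd (by omega) (hl.edge_ne _ _ _ k2 h2 h3)
    | (obtain ⟨e1, e2⟩ := hl.edge_inj _ _ _ _ h2 k2 h3 k3 (h5.symm.trans (heq.trans k5))
       exact hc.leaf_inj x y hx' h1 hy' k1 (hc.branch_inj _ _ ((hs.idx_par x h1).trans hx')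
        (hs.lvl_par x h1) ((hs.idx_par y k1).trans hy') (hs.lvl_par y k1) e1) e2)

/-- The signed form of the edge conditions in `IsLobeLabeling`. -/
theorem IsLobeLabeling.signed {d : ℕ} {K : ℕ → ℕ} {M : ℕ} {U : ℕ → ℤ} {g : ℕ → ℕ → ℤ}
    (hl : IsLobeLabeling d K M U g) :
    (∀ t j, t < d → j < K t → -M ≤ U t - g t j ∧ U t - g t j ≤ M ∧ U t - g t j ≠ 0) ∧
    (∀ s t i j, s < d → t < d → i < K s → j < K t → U s - g s i = U t - g t j →
      s = t ∧ i = j) ∧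
    (∀ s t i j, s < d → t < d → i < K s → j < K t → U s - g s i ≠ -(U t - g t j)) ∧
    (∀ s t j, s < d → t < d → j < K t → U t - g t j ≠ U s ∧ U t - g t j ≠ -U s) := by
  have h0 : ∀ t j, t < d → j < K t → -M ≤ U t - g t j ∧ U t - g t j ≤ M ∧ U t - g t j ≠ 0 := by
    intro t j ht hj
    obtain ⟨h1, h2⟩ := hl.edge_mem t j ht hj
    rw [abs_le] at h2
    exact ⟨h2.1, h2.2, fun h => by simp [h] at h1⟩
  refine ⟨h0, ?_, ?_, ?_⟩
  · intro s t i j hs ht hi hj h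
    exact hl.edge_inj s t i j hs ht hi hj (congrArg abs h)
  · intro s t i j hs ht hi hj h
    obtain ⟨rfl, rfl⟩ := hl.edge_inj s t i j hs ht hi hj (by simp only [h, abs_neg])
    have := (h0 s i hs hi).2.2
    omega
  · intro s t j hs ht hj
    have h1 := hl.edge_ne s t j hs ht hj
    have h2 := hl.branch_mem s hs
    constructor
    · intro h
      rw [h, abs_of_nonneg (by omega)] at h1
      exact h1 rfl
    · intro h
      rw [h, abs_neg, abs_of_nonneg (by omega)] at h1
      exact h1 rfl

/-- Vertex labels, in increasing order: 0 at `v i`; in `1, …, M` the leaves of lobe `i` and the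
branches of lobe `i + 1`; the pendant vertices of lobe `i + 1`; the shifted tail; `H` at `v (i +
1)`; in `H + 1, …, H + M` the branches of lobe `i` and the leaves of lobe `i + 1`; the pendant
vertices of lobe `i`. Edge labels: below `R` inside the tail, `R` on the spine edge to the tail, `R
+ 1, …, R + P'` at the pendant vertices of lobe `i + 1`, then `H ± U` and `H ± (U - g)` within
distance `M` of the spine edge label `H`, and finally the pendant vertices of lobe `i`. As signs
matter here, the edge conditions are needed in signed form. -/
theorem IsLobsterShape.exists_isTailLabeling_pair (hs : IsLobsterShape n v idx lvl par)
    {i : ℕ} (hi : i + 1 ≤ n) {d : ℕ} {K : ℕ → ℕ} {P P' : ℕ} {c c' : V → ℕ}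
    (hc : IsLobeCoding idx lvl par i d K P c)
    (hc' : IsLobeCoding idx lvl par (i + 1) d K P' c')
    {U : ℕ → ℤ} {g : ℕ → ℕ → ℤ}
    (hl : IsLobeLabeling d K (d + ∑ t ∈ Finset.range d, K t) U g)
    {f' : V → ℤ} (hf' : IsTailLabeling n v idx par (i + 2) f') :
    ∃ f, IsTailLabeling n v idx par i f := by
  classical
  set M := d + ∑ t ∈ Finset.range d, K t with hM
  obtain ⟨nonneg', lt_card', inj', root', edge_lt', edge_inj'⟩ := hf'
  have hcard : (Finset.univ.filter fun x => i ≤ idx x).card =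
      2 * (M + 1) + P + P' + (Finset.univ.filter fun x => i + 2 ≤ idx x).card := by
    have e1 : (Finset.univ.filter fun x => i ≤ idx x) =
        (Finset.univ.filter fun x => idx x = i) ∪ ((Finset.univ.filter fun x => idx x = i + 1) ∪
          Finset.univ.filter fun x => i + 2 ≤ idx x) := by
      ext x
      simp only [Finset.mem_filter, Finset.mem_univ, true_and, Finset.mem_union]
      omega
    rw [e1, Finset.card_union_of_disjoint, Finset.card_union_of_disjoint, hc.card_eq,
      hc'.card_eq]
    · omega
    · rw [Finset.disjoint_left]
      intro x
      simp only [Finset.mem_filter, Finset.mem_univ, true_and]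
      omega
    · rw [Finset.disjoint_left]
      intro x
      simp only [Finset.mem_filter, Finset.mem_univ, true_and, Finset.mem_union]
      omega
  set R := (Finset.univ.filter fun x => i + 2 ≤ idx x).card with hR
  set H : ℤ := M + 1 + P' + R with hH
  let f : V → ℤ := fun x =>
    if idx x = i then
      if lvl x = 0 then 0 else if lvl x = 1 then H + U (c x) else
      if lvl x = 2 then g (c (par x)) (c x) else H + M + 1 + c x
    else if idx x = i + 1 then
      if lvl x = 0 then H else if lvl x = 1 then U (c' x) else
      if lvl x = 2 then H + g (c' (par x)) (c' x) else M + 1 + c' x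
    else M + 1 + P' + f' x
  have hv0 : f (v i) = 0 := by
    simp [f, hs.idx_spine i (by omega), hs.lvl_spine i (by omega)]
  have hv1 : f (v (i + 1)) = H := by
    simp [f, hs.idx_spine (i + 1) (by omega), hs.lvl_spine (i + 1) (by omega)]
  obtain ⟨hD, hDinj, hDneg, hDU⟩ := hl.signed
  -- Only the first spinal vertex of the tail has its parent outside the tail, so all other tail
  -- edges keep their labels under the shift.
  have htail : ∀ x, i + 2 ≤ idx x → x ≠ v (i + 2) → i + 2 ≤ idx (par x) := by
    intro x hx hne
    have h3 := hs.lvl_le x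
    have h4 : lvl x = 0 ∨ lvl x = 1 ∨ lvl x = 2 ∨ lvl x = 3 := by omega
    have hn := hs.idx_le x
    rcases h4 with h | h | h | h
    · obtain ⟨j, hj⟩ : ∃ j, idx x = j + 1 := ⟨idx x - 1, by omega⟩
      have hxe := hs.eq_spine x h
      rw [hj] at hxe
      have : j + 1 ≠ i + 2 := by
        intro hj'
        rw [hj'] at hxe
        exact hne hxe
      rw [hxe, hs.par_spine j (by omega), hs.idx_spine j (by omega)]
      omega
    · rw [hs.par_branch x h, hs.idx_spine _ hn]; exact hx
    · rw [hs.idx_par x h]; exact hx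
    · rw [hs.par_pendant x h, hs.idx_spine _ hn]; exact hx
  have hcls : ∀ x, i ≤ idx x →
      (x = v i ∧ f x = 0) ∨
      (idx x = i ∧ lvl x = 1 ∧ c x < d ∧ (1 ≤ U (c x) ∧ U (c x) ≤ M) ∧ f x = H + U (c x) ∧
        |f x - f (par x)| = H + U (c x)) ∨
      (idx x = i ∧ lvl x = 2 ∧ c (par x) < d ∧ c x < K (c (par x)) ∧
        (1 ≤ g (c (par x)) (c x) ∧ g (c (par x)) (c x) ≤ M) ∧
        (-M ≤ U (c (par x)) - g (c (par x)) (c x) ∧ U (c (par x)) - g (c (par x)) (c x) ≤ M ∧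
          U (c (par x)) - g (c (par x)) (c x) ≠ 0) ∧
        f x = g (c (par x)) (c x) ∧
        |f x - f (par x)| = H + (U (c (par x)) - g (c (par x)) (c x))) ∨
      (idx x = i ∧ lvl x = 3 ∧ c x < P ∧ f x = H + M + 1 + c x ∧
        |f x - f (par x)| = H + M + 1 + c x) ∨
      (x = v (i + 1) ∧ f x = H ∧ |f x - f (par x)| = H) ∨
      (idx x = i + 1 ∧ lvl x = 1 ∧ c' x < d ∧ (1 ≤ U (c' x) ∧ U (c' x) ≤ M) ∧ f x = U (c' x) ∧
        |f x - f (par x)| = H - U (c' x)) ∨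
      (idx x = i + 1 ∧ lvl x = 2 ∧ c' (par x) < d ∧ c' x < K (c' (par x)) ∧
        (1 ≤ g (c' (par x)) (c' x) ∧ g (c' (par x)) (c' x) ≤ M) ∧
        (-M ≤ U (c' (par x)) - g (c' (par x)) (c' x) ∧
          U (c' (par x)) - g (c' (par x)) (c' x) ≤ M ∧
          U (c' (par x)) - g (c' (par x)) (c' x) ≠ 0) ∧
        f x = H + g (c' (par x)) (c' x) ∧
        |f x - f (par x)| = H - (U (c' (par x)) - g (c' (par x)) (c' x))) ∨
      (idx x = i + 1 ∧ lvl x = 3 ∧ c' x < P' ∧ f x = M + 1 + c' x ∧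
        |f x - f (par x)| = H - (M + 1 + c' x)) ∨
      (i + 2 ≤ idx x ∧ (0 ≤ f' x ∧ f' x < R) ∧ f x = M + 1 + P' + f' x ∧
        ((x = v (i + 2) ∧ |f x - f (par x)| = R) ∨
          (x ≠ v (i + 2) ∧ |f x - f (par x)| = |f' x - f' (par x)| ∧
            |f x - f (par x)| < R))) := by
    intro x hx
    have h3 := hs.lvl_le x
    have h4 : lvl x = 0 ∨ lvl x = 1 ∨ lvl x = 2 ∨ lvl x = 3 := by omega
    have h5 : idx x = i ∨ idx x = i + 1 ∨ i + 2 ≤ idx x := by omega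
    rcases h5 with hx' | hx' | hx'
    · rcases h4 with h | h | h | h
      · left
        refine ⟨?_, by simp [f, h, hx']⟩
        rw [hs.eq_spine x h, hx']
      · right; left
        have h1 := hc.branch_lt x hx' h
        have h2 := hl.branch_mem _ h1
        have h5 : f x = H + U (c x) := by simp [f, h, hx']
        refine ⟨hx', h, h1, h2, h5, ?_⟩
        rw [hs.par_branch x h, hx', hv0, h5, sub_zero, abs_of_nonneg (by omega)]
      · right; right; left
        have h1 := hc.leaf_lt x hx' h
        have h0 := hc.branch_lt (par x) ((hs.idx_par x h).trans hx') (hs.lvl_par x h)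
        have h5 : f x = g (c (par x)) (c x) := by simp [f, h, hx']
        have h6 : f (par x) = H + U (c (par x)) := by
          simp [f, hs.lvl_par x h, hs.idx_par x h, hx']
        have h7 := hD _ _ h0 h1
        refine ⟨hx', h, h0, h1, hl.leaf_mem _ _ h0 h1, h7, h5, ?_⟩
        rw [h5, h6, abs_sub_comm, abs_of_nonneg (by omega)]
        ring
      · right; right; right; left
        have h1 := hc.pendant_lt x hx' h
        have h5 : f x = H + M + 1 + c x := by simp [f, h, hx']
        refine ⟨hx', h, h1, h5, ?_⟩
        rw [hs.par_pendant x h, hx', hv0, h5, sub_zero, abs_of_nonneg (by omega)]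
    · rcases h4 with h | h | h | h
      · right; right; right; right; left
        have h0 : x = v (i + 1) := by rw [hs.eq_spine x h, hx']
        refine ⟨h0, by rw [h0, hv1], ?_⟩
        rw [h0, hs.par_spine i (by omega), hv0, hv1, sub_zero, abs_of_nonneg (by omega)]
      · right; right; right; right; right; left
        have h1 := hc'.branch_lt x hx' h
        have h2 := hl.branch_mem _ h1
        have h5 : f x = U (c' x) := by simp [f, h, hx']
        refine ⟨hx', h, h1, h2, h5, ?_⟩
        rw [hs.par_branch x h, hx', hv1, h5, abs_sub_comm, abs_of_nonneg (by omega)]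
      · right; right; right; right; right; right; left
        have h1 := hc'.leaf_lt x hx' h
        have h0 := hc'.branch_lt (par x) ((hs.idx_par x h).trans hx') (hs.lvl_par x h)
        have h5 : f x = H + g (c' (par x)) (c' x) := by simp [f, h, hx']
        have h6 : f (par x) = U (c' (par x)) := by
          simp [f, hs.lvl_par x h, hs.idx_par x h, hx']
        have h7 := hD _ _ h0 h1
        refine ⟨hx', h, h0, h1, hl.leaf_mem _ _ h0 h1, h7, h5, ?_⟩
        rw [h5, h6, abs_of_nonneg (by omega)]
        ring
      · right; right; right; right; right; right; right; left
        have h1 := hc'.pendant_lt x hx' h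
        have h5 : f x = M + 1 + c' x := by simp [f, h, hx']
        refine ⟨hx', h, h1, h5, ?_⟩
        rw [hs.par_pendant x h, hx', hv1, h5, abs_sub_comm, abs_of_nonneg (by omega)]
    · right; right; right; right; right; right; right; right
      have h5 : ∀ y, i + 2 ≤ idx y → f y = M + 1 + P' + f' y := by
        intro y hy
        simp [f, show idx y ≠ i by omega, show idx y ≠ i + 1 by omega]
      refine ⟨hx', ⟨nonneg' x hx', lt_card' x hx'⟩, h5 x hx', ?_⟩
      by_cases hxv : x = v (i + 2)
      · have hn : i + 2 ≤ n := hx'.trans (hs.idx_le x)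
        refine Or.inl ⟨hxv, ?_⟩
        rw [h5 x hx', hxv, hs.par_spine (i + 1) (by omega), hv1, root' hn, abs_sub_comm,
          abs_of_nonneg (by omega)]
        omega
      · have h6 : |f x - f (par x)| = |f' x - f' (par x)| := by
          rw [h5 x hx', h5 (par x) (htail x hx' hxv)]
          congr 1
          ring
        exact Or.inr ⟨hxv, h6, h6 ▸ edge_lt' x hx' hxv⟩
  have leaf_eq : ∀ x y, idx x = i → lvl x = 2 → idx y = i → lvl y = 2 →
      c (par x) = c (par y) ∧ c x = c y → x = y := by
    intro x y hx h1 hy k1 e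
    exact hc.leaf_inj x y hx h1 hy k1 (hc.branch_inj _ _ ((hs.idx_par x h1).trans hx)
      (hs.lvl_par x h1) ((hs.idx_par y k1).trans hy) (hs.lvl_par y k1) e.1) e.2
  have leaf_eq' : ∀ x y, idx x = i + 1 → lvl x = 2 → idx y = i + 1 → lvl y = 2 →
      c' (par x) = c' (par y) ∧ c' x = c' y → x = y := by
    intro x y hx h1 hy k1 e
    exact hc'.leaf_inj x y hx h1 hy k1 (hc'.branch_inj _ _ ((hs.idx_par x h1).trans hx)
      (hs.lvl_par x h1) ((hs.idx_par y k1).trans hy) (hs.lvl_par y k1) e.1) e.2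
  refine ⟨f, ⟨?_, ?_, ?_, fun _ => hv0, ?_, ?_⟩⟩
  · intro x hx
    rcases hcls x hx with h | h | h | h | h | h | h | h | h <;> omega
  · intro x hx
    rw [hcard]
    push_cast
    rcases hcls x hx with h | h | h | h | h | h | h | h | h <;> omega
  · intro x y hx hy heq
    rcases hcls x hx with h | ⟨h0, h1, h2, h3, h4, -⟩ | ⟨h0, h1, h2, h3, h4, -, h5, -⟩ |
      ⟨h0, h1, h2, h3, -⟩ | ⟨h1, h2, -⟩ | ⟨h0, h1, h2, h3, h4, -⟩ |
      ⟨h0, h1, h2, h3, h4, -, h5, -⟩ | ⟨h0, h1, h2, h3, -⟩ | ⟨h0, h1, h2, -⟩ <;>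
    rcases hcls y hy with k | ⟨k0, k1, k2, k3, k4, -⟩ | ⟨k0, k1, k2, k3, k4, -, k5, -⟩ |
      ⟨k0, k1, k2, k3, -⟩ | ⟨k1, k2, -⟩ | ⟨k0, k1, k2, k3, k4, -⟩ |
      ⟨k0, k1, k2, k3, k4, -, k5, -⟩ | ⟨k0, k1, k2, k3, -⟩ | ⟨k0, k1, k2, -⟩ <;>
    first
    | (exfalso; omega)
    | exact h.1.trans k.1.symm
    | exact h1.trans k1.symm
    | exact hc.branch_inj x y h0 h1 k0 k1 (hl.branch_inj _ h2 _ k2 (by omega))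
    | exact hc'.branch_inj x y h0 h1 k0 k1 (hl.branch_inj _ h2 _ k2 (by omega))
    | exact hc.pendant_inj x y h0 h1 k0 k1 (by omega)
    | exact hc'.pendant_inj x y h0 h1 k0 k1 (by omega)
    | exact absurd (by omega) (hl.leaf_ne _ _ _ h2 k2 k3)
    | exact absurd (by omega) (hl.leaf_ne _ _ _ k2 h2 h3)
    | exact leaf_eq x y h0 h1 k0 k1 (hl.leaf_inj _ _ _ _ h2 k2 h3 k3 (by omega))
    | exact leaf_eq' x y h0 h1 k0 k1 (hl.leaf_inj _ _ _ _ h2 k2 h3 k3 (by omega))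
    | exact inj' x y h0 k0 (by omega)
  · intro x hx hne
    rw [hcard]
    push_cast
    rcases hcls x hx with h | h | h | h | h | h | h | h | h
    · exact absurd h.1 hne
    all_goals omega
  · intro x y hx hy hnx hny heq
    rcases hcls x hx with h | ⟨h0, h1, h2, h3, -, h4⟩ | ⟨h0, h1, h2, h3, -, h5, -, h4⟩ |
      ⟨h0, h1, h2, -, h3⟩ | ⟨h1, -, h2⟩ | ⟨h0, h1, h2, h3, -, h4⟩ |
      ⟨h0, h1, h2, h3, -, h5, -, h4⟩ | ⟨h0, h1, h2, -, h3⟩ |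
      ⟨h0, -, -, ⟨h1, h2⟩ | ⟨h1, h2, h3⟩⟩
    · exact absurd h.1 hnx
    all_goals
      rcases hcls y hy with k | ⟨k0, k1, k2, k3, -, k4⟩ | ⟨k0, k1, k2, k3, -, k5, -, k4⟩ |
        ⟨k0, k1, k2, -, k3⟩ | ⟨k1, -, k2⟩ | ⟨k0, k1, k2, k3, -, k4⟩ |
        ⟨k0, k1, k2, k3, -, k5, -, k4⟩ | ⟨k0, k1, k2, -, k3⟩ |
        ⟨k0, -, -, ⟨k1, k2⟩ | ⟨k1, k2, k3⟩⟩
      · exact absurd k.1 hny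
      -- Most pairs of classes have disjoint ranges of edge labels. The other coincidences are
      -- within one class, or among the labels `H ± U`, `H ± (U - g)`, where the signed conditions
      -- apply.
      all_goals first
        | (exfalso; omega)
        | exact h1.trans k1.symm
        | exact edge_inj' x y h0 k0 h1 k1 (h2.symm.trans (heq.trans k2))
        | exact hc.branch_inj x y h0 h1 k0 k1 (hl.branch_inj _ h2 _ k2 (by omega))
        | exact hc'.branch_inj x y h0 h1 k0 k1 (hl.branch_inj _ h2 _ k2 (by omega))
        | exact hc.pendant_inj x y h0 h1 k0 k1 (by omega)
        | exact hc'.pendant_inj x y h0 h1 k0 k1 (by omega)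
        | exact leaf_eq x y h0 h1 k0 k1 (hDinj _ _ _ _ h2 k2 h3 k3 (by omega))
        | exact leaf_eq' x y h0 h1 k0 k1 (hDinj _ _ _ _ h2 k2 h3 k3 (by omega))
        | exact absurd (by omega) (hDneg _ _ _ _ h2 k2 h3 k3)
        | exact absurd (by omega) (hDU _ _ _ h2 k2 k3).1
        | exact absurd (by omega) (hDU _ _ _ k2 h2 h3).1
        | exact absurd (by omega) (hDU _ _ _ h2 k2 k3).2
        | exact absurd (by omega) (hDU _ _ _ k2 h2 h3).2

/-- A lobster of the given shape has a graceful labeling if the lobes `i` and `i + 1`, for `i`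
even, have the same odd number of branches with the same numbers of leaves. -/
theorem IsLobsterShape.exists_isTailLabeling (hs : IsLobsterShape n v idx lvl par)
    (h : ∀ i ≤ n, Even i → ∃ (d : ℕ) (K : ℕ → ℕ), Odd d ∧ (∀ t < d, 0 < K t) ∧
      (∀ s t, s ≤ t → t < d → Odd (K t) → Odd (K s)) ∧
      (∃ P c, IsLobeCoding idx lvl par i d K P c) ∧
      (i + 1 ≤ n → ∃ P c, IsLobeCoding idx lvl par (i + 1) d K P c)) :
    ∃ f, IsTailLabeling n v idx par 0 f := by
  suffices H : ∀ j i, n + 1 - i = j → Even i → ∃ f, IsTailLabeling n v idx par i f from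
    H _ 0 rfl Even.zero
  intro j
  induction j using Nat.strong_induction_on with
  | _ j ih =>
    intro i hj hi
    by_cases hin : i ≤ n
    · obtain ⟨d, K, hd, hK, hodd, ⟨P, c, hc⟩, h'⟩ := h i hin hi
      obtain ⟨U, g, hl⟩ := exists_isLobeLabeling hd hK hodd
      by_cases hin' : i + 1 ≤ n
      · obtain ⟨P', c', hc'⟩ := h' hin'
        obtain ⟨f', hf'⟩ := ih (n + 1 - (i + 2)) (by omega) (i + 2) rfl
          (hi.add even_two)
        exact hs.exists_isTailLabeling_pair hin' hc hc' hl hf'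
      · obtain rfl : i = n := by omega
        exact hs.exists_isTailLabeling_last hc hl
    -- Past the end of the spine the tail is empty; this is where an even number of lobes
    -- terminates.
    · have hx : ∀ x, ¬ i ≤ idx x := fun x hx => hin (hx.trans (hs.idx_le x))
      exact ⟨fun _ => 0, fun x h => absurd h (hx x), fun x h => absurd h (hx x),
        fun x y h => absurd h (hx x), fun _ => rfl, fun x h => absurd h (hx x),
        fun x y h => absurd h (hx x)⟩

/-! ### Counting and numbering the vertices of a lobe. -/

/-- The neighbours of the `i`-th spinal vertex in its reduced lobe. -/
def branches (idx lvl : V → ℕ) (i : ℕ) : Finset V :=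
  Finset.univ.filter fun x => idx x = i ∧ lvl x = 1

open scoped Classical in
/-- The number of vertices of level two whose parent is `w`. -/
noncomputable def leafCount (lvl : V → ℕ) (par : V → V) (w : V) : ℕ :=
  (Finset.univ.filter fun x => lvl x = 2 ∧ par x = w).card

theorem mem_branches {i : ℕ} {x : V} : x ∈ branches idx lvl i ↔ idx x = i ∧ lvl x = 1 := by
  simp [branches]

theorem IsLobsterShape.card_reduced (hs : IsLobsterShape n v idx lvl par) {i : ℕ} (hi : i ≤ n) :
    (Finset.univ.filter fun x => idx x = i ∧ lvl x ≠ 3).card =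
      1 + (branches idx lvl i).card + ∑ w ∈ branches idx lvl i, leafCount lvl par w := by
  classical
  have e1 : (Finset.univ.filter fun x => idx x = i ∧ lvl x ≠ 3) =
      ({v i} ∪ branches idx lvl i) ∪ Finset.univ.filter fun x => idx x = i ∧ lvl x = 2 := by
    ext x
    have h3 := hs.lvl_le x
    simp only [Finset.mem_filter, Finset.mem_univ, true_and, Finset.mem_union,
      Finset.mem_singleton, mem_branches]
    constructor
    · rintro ⟨h1, h2⟩
      by_cases h0 : lvl x = 0
      · left; left
        rw [hs.eq_spine x h0, h1]
      · omega
    · rintro ((rfl | h) | h)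
      · rw [hs.idx_spine i hi, hs.lvl_spine i hi]; omega
      · omega
      · omega
  have e2 : (Finset.univ.filter fun x => idx x = i ∧ lvl x = 2).card =
      ∑ w ∈ branches idx lvl i, leafCount lvl par w := by
    rw [Finset.card_eq_sum_card_fiberwise (f := par) (t := branches idx lvl i)]
    · refine Finset.sum_congr rfl fun w hw => ?_
      rw [mem_branches] at hw
      unfold leafCount
      congr 1
      ext x
      simp only [Finset.mem_filter, Finset.mem_univ, true_and]
      constructor
      · rintro ⟨⟨-, h⟩, h'⟩; exact ⟨h, h'⟩
      · rintro ⟨h, h'⟩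
        exact ⟨⟨by rw [← hs.idx_par x h, h', hw.1], h⟩, h'⟩
    · intro x hx
      simp only [Finset.coe_filter, Finset.mem_univ, true_and, Set.mem_ofPred_eq] at hx
      exact mem_branches.2 ⟨(hs.idx_par x hx.2).trans hx.1, hs.lvl_par x hx.2⟩
  rw [e1, Finset.card_union_of_disjoint, Finset.card_union_of_disjoint, e2,
    Finset.card_singleton]
  · rw [Finset.disjoint_left]
    intro x hx hx'
    rw [Finset.mem_singleton] at hx
    rw [mem_branches, hx, hs.lvl_spine i hi] at hx'
    omega
  · rw [Finset.disjoint_left]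
    intro x hx hx'
    simp only [Finset.mem_filter, Finset.mem_univ, true_and, Finset.mem_union,
      Finset.mem_singleton, mem_branches] at hx hx'
    rcases hx with rfl | hx
    · rw [hs.lvl_spine i hi] at hx'; omega
    · omega

theorem exists_numbering {α : Type*} (T : Finset α) :
    ∃ e : α → ℕ, (∀ x ∈ T, e x < T.card) ∧ ∀ x ∈ T, ∀ y ∈ T, e x = e y → x = y := by
  classical
  refine ⟨fun x => if h : x ∈ T then T.equivFin ⟨x, h⟩ else 0, ?_, ?_⟩
  · intro x hx
    simp [hx]
  · intro x hx y hy h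
    simpa [hx, hy, Fin.val_inj] using h

/-- The map `t` numbers the branches at the `i`-th spinal vertex by the numbers less than `d`,
and the branch with number `s` has `K s` leaves. -/
structure IsBranchNumbering (idx lvl : V → ℕ) (par : V → V) (i d : ℕ) (K : ℕ → ℕ)
    (t : V → ℕ) : Prop where
  card_eq : (branches idx lvl i).card = d
  lt : ∀ w ∈ branches idx lvl i, t w < d
  inj : ∀ w ∈ branches idx lvl i, ∀ w' ∈ branches idx lvl i, t w = t w' → w = w'
  leafCount_eq : ∀ w ∈ branches idx lvl i, leafCount lvl par w = K (t w)

theorem image_eq_range {α : Type*} {B : Finset α} {t : α → ℕ}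
    (hlt : ∀ w ∈ B, t w < B.card) (hinj : ∀ w ∈ B, ∀ w' ∈ B, t w = t w' → w = w') :
    B.image t = Finset.range B.card := by
  apply Finset.eq_of_subset_of_card_le
  · intro s hs
    obtain ⟨w, hw, rfl⟩ := Finset.mem_image.1 hs
    exact Finset.mem_range.2 (hlt w hw)
  · rw [Finset.card_range, Finset.card_image_of_injOn fun w hw w' hw' h => hinj w hw w' hw' h]

theorem IsLobsterShape.exists_isLobeCoding (hs : IsLobsterShape n v idx lvl par) {i : ℕ}
    (hi : i ≤ n) {d : ℕ} {K : ℕ → ℕ} {t : V → ℕ} (ht : IsBranchNumbering idx lvl par i d K t) :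
    ∃ P c, IsLobeCoding idx lvl par i d K P c := by
  classical
  obtain ⟨rfl, hlt, hinj, hK⟩ := ht
  choose e he hei using fun w : V =>
    exists_numbering (Finset.univ.filter fun x => lvl x = 2 ∧ par x = w)
  obtain ⟨q, hq, hqi⟩ := exists_numbering (Finset.univ.filter fun x => idx x = i ∧ lvl x = 3)
  refine ⟨(Finset.univ.filter fun x => idx x = i ∧ lvl x = 3).card,
    fun x => if lvl x = 1 then t x else if lvl x = 2 then e (par x) x else q x,
    ?_, ?_, ?_, ?_, ?_, ?_, ?_⟩
  · intro x hx h
    simpa [h] using hlt x (mem_branches.2 ⟨hx, h⟩)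
  · intro x y hx h hy h' heq
    simp only [h, h', if_true] at heq
    exact hinj x (mem_branches.2 ⟨hx, h⟩) y (mem_branches.2 ⟨hy, h'⟩) heq
  · intro x hx h
    have h1 := he (par x) x (by simp [h])
    have h2 := hK (par x) (mem_branches.2 ⟨(hs.idx_par x h).trans hx, hs.lvl_par x h⟩)
    simp only [h, hs.lvl_par x h, if_true]
    rw [← h2]
    exact h1
  · intro x y hx h hy h' hp heq
    simp only [h, h', hp] at heq
    exact hei (par y) x (by simp [h, hp]) y (by simp [h']) heq
  · intro x hx h
    simpa [h] using hq x (by simp [hx, h])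
  · intro x y hx h hy h' heq
    simp only [h, h'] at heq
    exact hqi x (by simp [hx, h]) y (by simp [hy, h']) heq
  · have e1 : (Finset.univ.filter fun x => idx x = i) =
        (Finset.univ.filter fun x => idx x = i ∧ lvl x ≠ 3) ∪
          Finset.univ.filter fun x => idx x = i ∧ lvl x = 3 := by
      ext x
      simp only [Finset.mem_filter, Finset.mem_univ, true_and, Finset.mem_union]
      omega
    rw [e1, Finset.card_union_of_disjoint, hs.card_reduced hi, ← image_eq_range hlt hinj,
      Finset.sum_image fun w hw w' hw' h => hinj w hw w' hw' h, Finset.sum_congr rfl hK]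
    rw [Finset.disjoint_left]
    intro x
    simp only [Finset.mem_filter, Finset.mem_univ, true_and]
    omega

/-- Branches with an odd number of leaves are numbered before the others, the order required by the
leaf distribution. -/
theorem exists_isBranchNumbering (i : ℕ) :
    ∃ (K : ℕ → ℕ) (t : V → ℕ),
      IsBranchNumbering idx lvl par i (branches idx lvl i).card K t ∧
      (∀ s r, s ≤ r → r < (branches idx lvl i).card → Odd (K r) → Odd (K s)) := by
  classical
  set B := branches idx lvl i with hB
  set k := leafCount lvl par with hk
  obtain ⟨e, he, hei⟩ := exists_numbering (B.filter fun w => Odd (k w))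
  obtain ⟨e', he', hei'⟩ := exists_numbering (B.filter fun w => ¬ Odd (k w))
  have hcard := Finset.card_filter_add_card_filter_not (s := B) fun w => Odd (k w)
  set p := (B.filter fun w => Odd (k w)).card
  set p' := (B.filter fun w => ¬ Odd (k w)).card
  let t : V → ℕ := fun w => if Odd (k w) then e w else p + e' w
  have h1 : ∀ w ∈ B, Odd (k w) → t w = e w ∧ e w < p := fun w hw h =>
    ⟨by simp [t, h], he w (Finset.mem_filter.2 ⟨hw, h⟩)⟩
  have h2 : ∀ w ∈ B, ¬ Odd (k w) → t w = p + e' w ∧ e' w < p' := fun w hw h =>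
    ⟨by simp only [t, h, if_false], he' w (Finset.mem_filter.2 ⟨hw, h⟩)⟩
  have hlt : ∀ w ∈ B, t w < B.card := by
    intro w hw
    by_cases h : Odd (k w)
    · have := h1 w hw h; omega
    · have := h2 w hw h; omega
  have hinj : ∀ w ∈ B, ∀ w' ∈ B, t w = t w' → w = w' := by
    intro w hw w' hw' heq
    by_cases h : Odd (k w) <;> by_cases h' : Odd (k w')
    · have := h1 w hw h
      have := h1 w' hw' h'
      exact hei w (Finset.mem_filter.2 ⟨hw, h⟩) w' (Finset.mem_filter.2 ⟨hw', h'⟩) (by omega)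
    · have := h1 w hw h
      have := h2 w' hw' h'
      omega
    · have := h2 w hw h
      have := h1 w' hw' h'
      omega
    · have := h2 w hw h
      have := h2 w' hw' h'
      exact hei' w (Finset.mem_filter.2 ⟨hw, h⟩) w' (Finset.mem_filter.2 ⟨hw', h'⟩) (by omega)
  have hsurj : ∀ s < B.card, ∃ w ∈ B, t w = s := by
    intro s hs
    rw [← Finset.mem_range, ← image_eq_range hlt hinj] at hs
    exact Finset.mem_image.1 hs
  let K : ℕ → ℕ := fun s => if h : ∃ w ∈ B, t w = s then k h.choose else 0
  have hK : ∀ w ∈ B, k w = K (t w) := by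
    intro w hw
    have h : ∃ w' ∈ B, t w' = t w := ⟨w, hw, rfl⟩
    simp only [K, dif_pos h]
    rw [hinj _ h.choose_spec.1 w hw h.choose_spec.2]
  refine ⟨K, t, ⟨rfl, hlt, hinj, hK⟩, ?_⟩
  intro s r hsr hr hodd
  obtain ⟨w, hw, rfl⟩ := hsurj r hr
  obtain ⟨w', hw', rfl⟩ := hsurj s (by omega)
  rw [← hK w hw] at hodd
  rw [← hK w' hw']
  by_contra h
  have := h1 w hw hodd
  have := h2 w' hw' h
  omega

/-! ### Isomorphisms of reduced lobes. -/

/-- The maps `σ` and `τ` are mutually inverse isomorphisms between the reduced lobes `i` and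
`j`. -/
structure IsLobeIso (idx lvl : V → ℕ) (par : V → V) (i j : ℕ) (σ τ : V → V) : Prop where
  map : ∀ x, idx x = i → lvl x ≠ 3 → idx (σ x) = j ∧ lvl (σ x) ≠ 3
  inv : ∀ x, idx x = i → lvl x ≠ 3 → τ (σ x) = x
  adj : ∀ x, idx x = i → lvl x ≠ 0 → lvl x ≠ 3 →
    lvl (σ x) ≠ 0 ∧ par (σ x) = σ (par x) ∨ lvl (σ (par x)) ≠ 0 ∧ par (σ (par x)) = σ x

theorem IsLobeIso.inj {V : Type*} {idx lvl : V → ℕ} {par : V → V} {i j : ℕ} {σ τ : V → V}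
    (h : IsLobeIso idx lvl par i j σ τ) {x y : V} (hx : idx x = i)
    (hx' : lvl x ≠ 3) (hy : idx y = i) (hy' : lvl y ≠ 3) (hxy : σ x = σ y) :
    x = y := by
  rw [← h.inv x hx hx', hxy, h.inv y hy hy']

theorem exists_leaf {w : V} (h : 0 < leafCount lvl par w) : ∃ x, lvl x = 2 ∧ par x = w := by
  classical
  obtain ⟨x, hx⟩ := Finset.card_pos.1 h
  exact ⟨x, by simpa using hx⟩

theorem IsLobsterShape.lvl_par_eq_zero {V : Type*} {n : ℕ} {v : ℕ → V} {idx lvl : V → ℕ}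
    {par : V → V} (hs : IsLobsterShape n v idx lvl par) {x : V}
    (h : lvl x = 1) : lvl (par x) = 0 := by
  rw [hs.par_branch x h]
  exact hs.lvl_spine _ (hs.idx_le x)

/-- Two branches with leaves make `v i` the middle of a path with two edges on either side. If its
image had level 2, it would have only one neighbour in the reduced lobe. If it had level 1, its
neighbours other than `v j` would be leaves, so both branches, having a further neighbour, would be
sent to `v j`. -/
theorem IsLobeIso.map_root {i j : ℕ} {σ τ : V → V} (h : IsLobeIso idx lvl par i j σ τ)
    (hs : IsLobsterShape n v idx lvl par) (hi : i ≤ n)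
    (hpos : ∀ w, lvl w = 1 → 0 < leafCount lvl par w) (h2 : 2 ≤ (branches idx lvl i).card) :
    σ (v i) = v j := by
  obtain ⟨w, hw, w', hw', hne⟩ := Finset.one_lt_card.1 h2
  rw [mem_branches] at hw hw'
  obtain ⟨x, hx, hxw⟩ := exists_leaf (hpos w hw.2)
  obtain ⟨x', hx', hxw'⟩ := exists_leaf (hpos w' hw'.2)
  have hxi : idx x = i := by rw [← hs.idx_par x hx, hxw, hw.1]
  have hxi' : idx x' = i := by rw [← hs.idx_par x' hx', hxw', hw'.1]
  have hpw : par w = v i := by rw [hs.par_branch w hw.2, hw.1]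
  have hpw' : par w' = v i := by rw [hs.par_branch w' hw'.2, hw'.1]
  have hvi := hs.idx_spine i hi
  have hvl := hs.lvl_spine i hi
  have a1 := h.adj w hw.1 (by omega) (by omega)
  have a1' := h.adj w' hw'.1 (by omega) (by omega)
  have a2 := h.adj x hxi (by omega) (by omega)
  have a2' := h.adj x' hxi' (by omega) (by omega)
  rw [hpw] at a1
  rw [hpw'] at a1'
  rw [hxw] at a2
  rw [hxw'] at a2'
  have m0 := h.map (v i) hvi (by omega)
  have mw := h.map w hw.1 (by omega)
  have mw' := h.map w' hw'.1 (by omega)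
  have mx := h.map x hxi (by omega)
  have mx' := h.map x' hxi' (by omega)
  have nw : σ w ≠ σ w' := fun e => hne (h.inj hw.1 (by omega) hw'.1 (by omega) e)
  have nx : σ x ≠ σ (v i) := fun e => by
    rw [h.inj hxi (by omega) hvi (by omega) e] at hx; omega
  have nx' : σ x' ≠ σ (v i) := fun e => by
    rw [h.inj hxi' (by omega) hvi (by omega) e] at hx'; omega
  have key : ∀ y, lvl y ≠ 3 → lvl y ≠ 0 → lvl y = 1 ∧ lvl (par y) = 0 ∨
      lvl y = 2 ∧ lvl (par y) = 1 := by
    intro y hy hy'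
    have := hs.lvl_le y
    by_cases h1 : lvl y = 1
    · exact Or.inl ⟨h1, hs.lvl_par_eq_zero h1⟩
    · have h2 : lvl y = 2 := by omega
      exact Or.inr ⟨h2, hs.lvl_par y h2⟩
  by_contra hcon
  have h0 : lvl (σ (v i)) ≠ 0 := by
    intro h0
    exact hcon (by rw [hs.eq_spine _ h0, m0.1])
  have leaf_adj : ∀ y z, lvl y = 2 → lvl z ≠ 3 →
      (lvl z ≠ 0 ∧ par z = y ∨ lvl y ≠ 0 ∧ par y = z) → z = par y := by
    intro y z hy hz hyz
    rcases hyz with ⟨h1, rfl⟩ | ⟨-, h1⟩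
    · rcases key z hz h1 with h2 | h2 <;> omega
    · exact h1.symm
  rcases key _ m0.2 h0 with ⟨k1, k2⟩ | ⟨k1, k2⟩
  · have hleaf : ∀ w x, lvl (σ w) ≠ 3 → lvl (σ x) ≠ 3 → σ x ≠ σ (v i) →
        (lvl (σ w) ≠ 0 ∧ par (σ w) = σ (v i) ∨ lvl (σ (v i)) ≠ 0 ∧ par (σ (v i)) = σ w) →
        (lvl (σ x) ≠ 0 ∧ par (σ x) = σ w ∨ lvl (σ w) ≠ 0 ∧ par (σ w) = σ x) →
        par (σ (v i)) = σ w := by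
      intro w x hw hx hxv b1 b2
      rcases b1 with ⟨c1, c2⟩ | ⟨-, c2⟩
      · exfalso
        rcases key _ hw c1 with ⟨d1, d2⟩ | ⟨d1, d2⟩
        · rw [c2] at d2; omega
        · exact hxv ((leaf_adj _ _ d1 hx b2).trans c2)
      · exact c2
    exact nw ((hleaf w x mw.2 mx.2 nx a1 a2).symm.trans (hleaf w' x' mw'.2 mx'.2 nx' a1' a2'))
  · exact nw ((leaf_adj _ _ k1 mw.2 a1).trans (leaf_adj _ _ k1 mw'.2 a1').symm)

/-- An inequality suffices, since the inverse isomorphism gives the opposite one. -/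
theorem IsLobeIso.map_branch {i j : ℕ} {σ τ : V → V} (h : IsLobeIso idx lvl par i j σ τ)
    (hs : IsLobsterShape n v idx lvl par) (hi : i ≤ n) (hj : j ≤ n) (hroot : σ (v i) = v j)
    {w : V} (hw : w ∈ branches idx lvl i) :
    σ w ∈ branches idx lvl j ∧ leafCount lvl par w ≤ leafCount lvl par (σ w) := by
  classical
  rw [mem_branches] at hw
  have hpw : par w = v i := by rw [hs.par_branch w hw.2, hw.1]
  have a1 := h.adj w hw.1 (by omega) (by omega)
  rw [hpw, hroot, hs.lvl_spine j hj] at a1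
  have mw := h.map w hw.1 (by omega)
  have hl := hs.lvl_le (σ w)
  have h1 : lvl (σ w) = 1 := by
    by_contra h1
    have h2 : lvl (σ w) = 2 := by omega
    have h3 := hs.lvl_par _ h2
    rcases a1 with ⟨-, h4⟩ | ⟨h4, -⟩
    · rw [h4, hs.lvl_spine j hj] at h3; omega
    · exact h4 rfl
  refine ⟨mem_branches.2 ⟨mw.1, h1⟩, ?_⟩
  refine Finset.card_le_card_of_injOn σ ?_ ?_
  · intro x hx
    simp only [Finset.coe_filter, Finset.mem_univ, true_and, Set.mem_ofPred_eq] at hx ⊢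
    have hxi : idx x = i := by rw [← hs.idx_par x hx.1, hx.2, hw.1]
    have a2 := h.adj x hxi (by omega) (by omega)
    have mx := h.map x hxi (by omega)
    rw [hx.2] at a2
    rcases a2 with ⟨b1, b2⟩ | ⟨-, b2⟩
    · refine ⟨?_, b2⟩
      have := hs.lvl_le (σ x)
      by_contra hne
      have := hs.lvl_par_eq_zero (x := σ x) (by omega)
      rw [b2] at this
      omega
    · exfalso
      rw [hs.par_branch _ h1, mw.1, ← hroot] at b2
      have hxv := h.inj (hs.idx_spine i hi) (by rw [hs.lvl_spine i hi]; omega) hxi (by omega) b2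
      have := hs.lvl_spine i hi
      rw [hxv] at this
      omega
  · intro x hx y hy hxy
    simp only [Finset.coe_filter, Finset.mem_univ, true_and, Set.mem_ofPred_eq] at hx hy
    have hxi : idx x = i := by rw [← hs.idx_par x hx.1, hx.2, hw.1]
    have hyi : idx y = i := by rw [← hs.idx_par y hy.1, hy.2, hw.1]
    exact h.inj hxi (by omega) hyi (by omega) hxy

theorem IsLobeIso.card_branches_le {i j : ℕ} {σ τ : V → V} (h : IsLobeIso idx lvl par i j σ τ)
    (hs : IsLobsterShape n v idx lvl par) (hi : i ≤ n) (hj : j ≤ n) (hroot : σ (v i) = v j) :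
    (branches idx lvl i).card ≤ (branches idx lvl j).card := by
  refine Finset.card_le_card_of_injOn σ
    (fun w hw => (h.map_branch hs hi hj hroot hw).1) fun w hw w' hw' hww => ?_
  have h1 := mem_branches.1 (Finset.mem_coe.1 hw)
  have h2 := mem_branches.1 (Finset.mem_coe.1 hw')
  exact h.inj h1.1 (by omega) h2.1 (by omega) hww

theorem IsLobeIso.card_reduced_le {i j : ℕ} {σ τ : V → V}
    (h : IsLobeIso idx lvl par i j σ τ) :
    (Finset.univ.filter fun x => idx x = i ∧ lvl x ≠ 3).card ≤
      (Finset.univ.filter fun x => idx x = j ∧ lvl x ≠ 3).card := by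
  refine Finset.card_le_card_of_injOn σ (fun x hx => ?_) fun x hx y hy hxy => ?_
  · simp only [Finset.coe_filter, Finset.mem_univ, true_and, Set.mem_ofPred_eq] at hx ⊢
    exact h.map x hx.1 hx.2
  · simp only [Finset.coe_filter, Finset.mem_univ, true_and, Set.mem_ofPred_eq] at hx hy
    exact h.inj hx.1 hx.2 hy.1 hy.2 hxy

/-- A numbering of the branches can be transported along an isomorphism of reduced lobes, even
if the isomorphism does not respect the spinal vertices. -/
theorem IsBranchNumbering.transport {i j : ℕ} {σ τ : V → V}
    (h : IsLobeIso idx lvl par i j σ τ) (h' : IsLobeIso idx lvl par j i τ σ)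
    (hs : IsLobsterShape n v idx lvl par) (hi : i ≤ n) (hj : j ≤ n)
    (hpos : ∀ w, lvl w = 1 → 0 < leafCount lvl par w)
    (hodd : Odd (branches idx lvl i).card) (hodd' : Odd (branches idx lvl j).card)
    {d : ℕ} {K : ℕ → ℕ} {t : V → ℕ} (ht : IsBranchNumbering idx lvl par i d K t) :
    ∃ t', IsBranchNumbering idx lvl par j d K t' := by
  have hvi : lvl (v i) ≠ 3 := by rw [hs.lvl_spine i hi]; omega
  have hvj : lvl (v j) ≠ 3 := by rw [hs.lvl_spine j hj]; omega
  by_cases h2 : 2 ≤ (branches idx lvl i).card ∨ 2 ≤ (branches idx lvl j).card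
  · have hroot : σ (v i) = v j ∧ τ (v j) = v i := by
      rcases h2 with h2 | h2
      · have := h.map_root hs hi hpos h2
        exact ⟨this, by rw [← this, h.inv _ (hs.idx_spine i hi) hvi]⟩
      · have := h'.map_root hs hj hpos h2
        exact ⟨by rw [← this, h'.inv _ (hs.idx_spine j hj) hvj], this⟩
    refine ⟨fun w => t (τ w), ?_, ?_, ?_, ?_⟩
    · rw [← ht.card_eq]
      exact le_antisymm (h'.card_branches_le hs hj hi hroot.2)
        (h.card_branches_le hs hi hj hroot.1)
    · intro w hw
      exact ht.lt _ (h'.map_branch hs hj hi hroot.2 hw).1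
    · intro w hw w' hw' hww
      have := ht.inj _ (h'.map_branch hs hj hi hroot.2 hw).1 _
        (h'.map_branch hs hj hi hroot.2 hw').1 hww
      rw [mem_branches] at hw hw'
      exact h'.inj hw.1 (by omega) hw'.1 (by omega) this
    · intro w hw
      have h3 := h'.map_branch hs hj hi hroot.2 hw
      have h4 := h.map_branch hs hi hj hroot.1 h3.1
      rw [mem_branches] at hw
      rw [h'.inv w hw.1 (by omega)] at h4
      rw [← ht.leafCount_eq _ h3.1]
      exact le_antisymm h3.2 h4.2
  -- By oddness each lobe has exactly one branch, so it is a star centred there. An isomorphism may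
  -- exchange the spinal vertex with a leaf, but the number of vertices already determines the
  -- number of leaves.
  · have hci : (branches idx lvl i).card = 1 := by have := hodd.pos; omega
    have hcj : (branches idx lvl j).card = 1 := by have := hodd'.pos; omega
    have hcard := le_antisymm h.card_reduced_le h'.card_reduced_le
    rw [hs.card_reduced hi, hs.card_reduced hj, hci, hcj] at hcard
    obtain ⟨w, hw⟩ := Finset.card_eq_one.1 hci
    obtain ⟨w', hw'⟩ := Finset.card_eq_one.1 hcj
    rw [hw, hw', Finset.sum_singleton, Finset.sum_singleton] at hcard
    have hwm : w ∈ branches idx lvl i := by simp [hw]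
    refine ⟨fun _ => t w, ?_, ?_, ?_, ?_⟩
    · rw [← ht.card_eq, hci, hcj]
    · intro _ _
      exact ht.lt w hwm
    · intro x hx y hy _
      rw [hw', Finset.mem_singleton] at hx hy
      rw [hx, hy]
    · intro x hx
      rw [hw', Finset.mem_singleton] at hx
      rw [hx, ← ht.leafCount_eq w hwm]
      omega

end

/-! ### From the graph to its parent map. -/

open SimpleGraph

/-- In a finite tree, a choice of a smaller neighbour of every vertex but one exhausts the
edges. -/
theorem adj_iff_of_isTree {V : Type*} [Fintype V] {G : SimpleGraph V} (hG : G.IsTree) {a : V}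
    {par : V → V} {μ : V → ℕ} (hadj : ∀ x, x ≠ a → G.Adj x (par x))
    (hμ : ∀ x, x ≠ a → μ (par x) < μ x) (x y : V) :
    G.Adj x y ↔ x ≠ a ∧ par x = y ∨ y ≠ a ∧ par y = x := by
  classical
  constructor
  · intro h
    -- The edges from `x` to `par x` are pairwise distinct because `μ` decreases along `par`; there
    -- are as many of them as a tree has edges.
    have himg : (Finset.univ.erase a).image (fun x => s(x, par x)) = G.edgeFinset := by
      apply Finset.eq_of_subset_of_card_le
      · intro e he
        obtain ⟨x, hx, rfl⟩ := Finset.mem_image.1 he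
        simpa using hadj x (by simpa using hx)
      · have h1 := hG.card_edgeFinset
        rw [Finset.card_image_of_injOn, Finset.card_erase_of_mem (Finset.mem_univ a),
          Finset.card_univ]
        · omega
        · intro x hx y hy hxy
          have hx' : x ≠ a := by simpa using hx
          have hy' : y ≠ a := by simpa using hy
          have m1 := hμ x hx'
          have m2 := hμ y hy'
          rcases Sym2.eq_iff.1 hxy with ⟨h1, -⟩ | ⟨h1, h2⟩
          · exact h1
          · rw [h2] at m1
            rw [← h1] at m2
            omega
    have he : s(x, y) ∈ G.edgeFinset := by simpa using h
    rw [← himg] at he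
    obtain ⟨z, hz, hze⟩ := Finset.mem_image.1 he
    have hz' : z ≠ a := by simpa using hz
    rcases Sym2.eq_iff.1 hze with ⟨rfl, h2⟩ | ⟨rfl, h2⟩
    · exact Or.inl ⟨hz', h2⟩
    · exact Or.inr ⟨hz', h2⟩
  · rintro (⟨h, rfl⟩ | ⟨h, rfl⟩)
    · exact hadj x h
    · exact (hadj y h).symm

theorem exists_adj_adj_of_dist_le_two {V : Type*} {G : SimpleGraph V} (hG : G.Connected)
    {s x : V} (h : G.dist s x ≤ 2) :
    s = x ∨ G.Adj s x ∨ ∃ y, G.Adj s y ∧ G.Adj y x := by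
  obtain ⟨p, hp⟩ := hG.exists_walk_length_eq_dist s x
  rw [← hp] at h
  cases p with
  | nil => exact Or.inl rfl
  | cons h1 q =>
    cases q with
    | nil => exact Or.inr (Or.inl h1)
    | cons h2 r =>
      cases r with
      | nil => exact Or.inr (Or.inr ⟨_, h1, h2⟩)
      | cons h3 r => simp at h

/-- A lobster is given by its parent map. -/
theorem IsLobsterWithSpine.exists_shape {V : Type*} [Fintype V] {G : SimpleGraph V} {a b : V}
    {p : G.Walk a b} (hL : IsLobsterWithSpine G p) :
    ∃ (idx lvl : V → ℕ) (par : V → V), IsLobsterShape p.length p.getVert idx lvl par ∧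
      (∀ x y, G.Adj x y ↔ x ≠ a ∧ par x = y ∨ y ≠ a ∧ par y = x) ∧
      (∀ w, lvl w = 1 → 0 < leafCount lvl par w) := by
  classical
  have hinj : ∀ i j, i ≤ p.length → j ≤ p.length → p.getVert i = p.getVert j → i = j :=
    fun i j hi hj h => hL.isPath.getVert_injOn hi hj h
  have hpos : ∀ x ∈ p.support, ∃ i, i ≤ p.length ∧ p.getVert i = x := by
    intro x hx
    obtain ⟨i, h1, h2⟩ := Walk.mem_support_iff_exists_getVert.1 hx
    exact ⟨i, by assumption, by assumption⟩
  choose! pos hpos_le hpos_eq using hpos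
  have hpos_getVert : ∀ i ≤ p.length, pos (p.getVert i) = i := fun i hi =>
    hinj _ _ (hpos_le _ (p.getVert_mem_support i)) hi (hpos_eq _ (p.getVert_mem_support i))
  let near : V → Prop := fun x => x ∉ p.support ∧ ∃ s ∈ p.support, G.Adj x s
  have hfar : ∀ x, x ∉ p.support → ¬ near x → ∃ y, near y ∧ G.Adj x y := by
    intro x hx hn
    obtain ⟨s, hs, hd⟩ := hL.dist_le x
    rcases exists_adj_adj_of_dist_le_two hL.isTree.connected hd with rfl | h | ⟨y, h1, h2⟩
    · exact absurd hs hx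
    · exact absurd ⟨hx, s, hs, h.symm⟩ hn
    · refine ⟨y, ⟨fun hy => hn ⟨hx, y, hy, h2.symm⟩, s, hs, h1.symm⟩, h2.symm⟩
  -- Truncated subtraction makes `a` its own parent; this value is never used as an edge.
  have hpar : ∀ x, ∃ y, (x ∈ p.support → y = p.getVert (pos x - 1)) ∧
      (near x → y ∈ p.support ∧ G.Adj x y) ∧
      (x ∉ p.support → ¬ near x → near y ∧ G.Adj x y) := by
    intro x
    by_cases hx : x ∈ p.support
    · exact ⟨_, fun _ => rfl, fun h => absurd hx h.1, fun h => absurd hx h⟩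
    · by_cases hn : near x
      · obtain ⟨-, s, hs, h⟩ := id hn
        exact ⟨s, fun h => absurd h hx, fun _ => ⟨hs, h⟩, fun _ h => absurd hn h⟩
      · obtain ⟨y, hy, h⟩ := hfar x hx hn
        exact ⟨y, fun h => absurd h hx, fun h => absurd h hn, fun _ _ => ⟨hy, h⟩⟩
  choose par par_spine par_near par_far using hpar
  let idx : V → ℕ := fun x => if x ∈ p.support then pos x else
    if near x then pos (par x) else pos (par (par x))
  -- A neighbour of the spine is a branch or a pendant vertex according to whether it is the parent
  -- of some vertex at distance two.
  let lvl : V → ℕ := fun x => if x ∈ p.support then 0 else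
    if near x then (if ∃ y, y ∉ p.support ∧ ¬ near y ∧ par y = x then 1 else 3) else 2
  let μ : V → ℕ := fun x => if x ∈ p.support then pos x else
    if near x then p.length + 1 else p.length + 2
  have near_not : ∀ x, near x → x ∉ p.support := fun x h => h.1
  have lvl0 : ∀ x, lvl x = 0 → x ∈ p.support := by
    intro x h
    by_contra hx
    simp only [lvl, hx, if_false] at h
    split_ifs at h
  have lvl_near : ∀ x, lvl x = 1 ∨ lvl x = 3 → near x := by
    intro x h
    by_contra hx
    by_cases hx' : x ∈ p.support <;> simp [lvl, hx, hx'] at h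
  have lvl2 : ∀ x, lvl x = 2 → x ∉ p.support ∧ ¬ near x := by
    intro x h
    simp only [lvl] at h
    split_ifs at h <;> simp_all
  have idx_near : ∀ x, near x → par x = p.getVert (idx x) := by
    intro x hx
    simp only [idx, near_not x hx, hx, if_true, if_false]
    exact (hpos_eq _ (par_near x hx).1).symm
  have hadj : ∀ x, x ≠ a → G.Adj x (par x) ∧ μ (par x) < μ x := by
    intro x hxa
    by_cases hx : x ∈ p.support
    · obtain ⟨j, hj⟩ : ∃ j, pos x = j + 1 := by
        refine ⟨pos x - 1, ?_⟩
        have : pos x ≠ 0 := fun h0 => hxa (by rw [← hpos_eq x hx, h0, p.getVert_zero])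
        omega
      have hlen := hpos_le x hx
      have h1 : par x = p.getVert j := by rw [par_spine x hx, hj]; rfl
      have h2 : x = p.getVert (j + 1) := by rw [← hj, hpos_eq x hx]
      have h3 : μ (par x) = j := by
        simp only [μ, h1, p.getVert_mem_support, if_true]
        exact hpos_getVert j (by omega)
      have h4 : μ x = j + 1 := by simp only [μ, hx, if_true, hj]
      refine ⟨?_, by omega⟩
      rw [h1, h2]
      exact (p.adj_getVert_succ (by omega)).symm
    · by_cases hn : near x
      · have h1 := par_near x hn
        refine ⟨h1.2, ?_⟩
        have := hpos_le _ h1.1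
        simp only [μ, h1.1, hx, hn, if_true, if_false]
        omega
      · have h1 := par_far x hx hn
        refine ⟨h1.2, ?_⟩
        simp [μ, near_not _ h1.1, h1.1, hx, hn]
  refine ⟨idx, lvl, par, ?_, adj_iff_of_isTree hL.isTree (fun x hx => (hadj x hx).1)
    fun x hx => (hadj x hx).2, ?_⟩
  · constructor
    · intro x
      simp only [idx]
      split_ifs with h1 h2
      · exact hpos_le x h1
      · exact hpos_le _ (par_near x h2).1
      · exact hpos_le _ (par_near _ (par_far x h1 h2).1).1
    · intro x
      simp only [lvl]
      split_ifs <;> omega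
    · intro x h
      simp only [idx, lvl0 x h, if_true, hpos_eq x (lvl0 x h)]
    · intro i hi
      simp only [lvl, p.getVert_mem_support, if_true]
    · intro i hi
      simp only [idx, p.getVert_mem_support, if_true, hpos_getVert i hi]
    · intro i hi
      rw [par_spine _ (p.getVert_mem_support _), hpos_getVert (i + 1) (by omega)]
      rfl
    · exact fun x h => idx_near x (lvl_near x (Or.inl h))
    · exact fun x h => idx_near x (lvl_near x (Or.inr h))
    · intro x h
      obtain ⟨h1, h2⟩ := lvl2 x h
      have h3 := (par_far x h1 h2).1
      have h4 : ∃ y, y ∉ p.support ∧ ¬ near y ∧ par y = par x := ⟨x, h1, h2, rfl⟩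
      simp only [lvl, near_not _ h3, h3, h4, if_true, if_false]
    · intro x h
      obtain ⟨h1, h2⟩ := lvl2 x h
      have h3 := (par_far x h1 h2).1
      simp only [idx, near_not _ h3, h3, h1, h2, if_true, if_false]
  · intro w hw
    have h1 := lvl_near w (Or.inl hw)
    simp only [lvl, near_not w h1, h1, if_true, if_false] at hw
    split_ifs at hw with h2
    · obtain ⟨y, hy, hy', hyw⟩ := h2
      refine Finset.card_pos.2 ⟨y, ?_⟩
      simp [lvl, hy, hy', hyw]
    · omega

variable {V : Type*} {G : SimpleGraph V} {a b : V} {p : G.Walk a b} {idx lvl : V → ℕ}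
  {par : V → V}

/-! ### Lobes and reduced lobes in terms of index and level. -/

/-- Adjacency of vertices with the same index. -/
theorem IsLobsterShape.adj_iff (hs : IsLobsterShape p.length p.getVert idx lvl par)
    (hadj : ∀ x y, G.Adj x y ↔ x ≠ a ∧ par x = y ∨ y ≠ a ∧ par y = x) {x y : V}
    (hxy : idx x = idx y) :
    G.Adj x y ↔ lvl x ≠ 0 ∧ par x = y ∨ lvl y ≠ 0 ∧ par y = x := by
  -- A spinal vertex other than `a` has a parent of smaller index, so within one index excluding `a`
  -- amounts to excluding all spinal vertices.
  have key : ∀ x y, idx x = idx y → (x ≠ a ∧ par x = y ↔ lvl x ≠ 0 ∧ par x = y) := by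
    intro x y hxy
    refine and_congr_left fun hp => not_congr ?_
    constructor
    · rintro rfl
      have := hs.lvl_spine 0 (Nat.zero_le _)
      rwa [p.getVert_zero] at this
    · intro h0
      have hx := hs.eq_spine x h0
      have hle := hs.idx_le x
      rcases hi : idx x with _ | i
      · rw [hx, hi, p.getVert_zero]
      · exfalso
        rw [hi] at hx hle
        rw [hx, hs.par_spine i (by omega)] at hp
        have := hs.idx_spine i (by omega)
        rw [hp, ← hxy, hi] at this
        omega
  rw [hadj, key x y hxy, key y x hxy.symm]

theorem getVert_edge_mem {i : ℕ} (hi : i < p.length) :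
    s(p.getVert i, p.getVert (i + 1)) ∈ p.edges := by
  rw [← Walk.mem_edges_toSubgraph]
  exact p.toSubgraph_adj_getVert hi

theorem IsLobsterShape.mem_support_iff (hs : IsLobsterShape p.length p.getVert idx lvl par)
    (x : V) : x ∈ p.support ↔ lvl x = 0 := by
  constructor
  · intro h
    obtain ⟨i, h1, h2⟩ := Walk.mem_support_iff_exists_getVert.1 h
    have h3 := hs.lvl_spine i (by assumption)
    simp_all
  · intro h
    rw [hs.eq_spine x h]
    exact p.getVert_mem_support _

/-- The index changes only along spine edges, and following parents leads from any vertex to the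
spine without using one. -/
theorem IsLobsterShape.reachable_iff (hs : IsLobsterShape p.length p.getVert idx lvl par)
    (hadj : ∀ x y, G.Adj x y ↔ x ≠ a ∧ par x = y ∨ y ≠ a ∧ par y = x) {i : ℕ}
    (hi : i ≤ p.length) (x : V) :
    (G.deleteEdges {e | e ∈ p.edges}).Reachable (p.getVert i) x ↔ idx x = i := by
  have hpar : ∀ x, x ≠ a → s(x, par x) ∉ p.edges → idx (par x) = idx x := by
    intro x hxa hx
    have h3 := hs.lvl_le x
    have hle := hs.idx_le x
    have h4 : lvl x = 0 ∨ lvl x = 1 ∨ lvl x = 2 ∨ lvl x = 3 := by omega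
    rcases h4 with h | h | h | h
    · exfalso
      have hxe := hs.eq_spine x h
      rcases hi : idx x with _ | i
      · rw [hi, p.getVert_zero] at hxe
        exact hxa hxe
      · rw [hi] at hxe hle
        rw [hxe, hs.par_spine i (by omega), Sym2.eq_swap] at hx
        exact hx (getVert_edge_mem (by omega))
    · rw [hs.par_branch x h, hs.idx_spine _ hle]
    · exact hs.idx_par x h
    · rw [hs.par_pendant x h, hs.idx_spine _ hle]
  constructor
  · rintro ⟨q⟩
    have : ∀ {y z : V}, (G.deleteEdges {e | e ∈ p.edges}).Walk y z → idx y = idx z := by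
      intro y z q
      induction q with
      | nil => rfl
      | @cons y z _ h _ ih =>
        rw [← ih]
        rw [deleteEdges_adj] at h
        obtain ⟨h1, h2⟩ := h
        rcases (hadj _ _).1 h1 with ⟨h3, h4⟩ | ⟨h3, h4⟩
        · rw [← h4] at h2 ⊢
          exact (hpar y h3 h2).symm
        · rw [← h4, Sym2.eq_swap] at h2
          rw [← h4]
          exact hpar z h3 h2
    rw [← this q, hs.idx_spine i hi]
  · have step : ∀ x, lvl x ≠ 0 → (G.deleteEdges {e | e ∈ p.edges}).Reachable (par x) x := by
      intro x hx
      have hxs : x ∉ p.support := fun h => hx ((hs.mem_support_iff x).1 h)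
      refine (Adj.reachable ?_)
      rw [deleteEdges_adj]
      refine ⟨(hadj _ _).2 (Or.inr ⟨?_, rfl⟩), fun h => hxs (p.snd_mem_support_of_mem_edges h)⟩
      rintro rfl
      exact hxs p.start_mem_support
    intro hx
    have h3 := hs.lvl_le x
    have h4 : lvl x = 0 ∨ lvl x = 1 ∨ lvl x = 2 ∨ lvl x = 3 := by omega
    rcases h4 with h | h | h | h
    · rw [← hx, ← hs.eq_spine x h]
    · have := step x (by omega)
      rwa [hs.par_branch x h, hx] at this
    · have h1 := step x (by omega)
      have h2 := step (par x) (by rw [hs.lvl_par x h]; omega)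
      rw [hs.par_branch _ (hs.lvl_par x h), hs.idx_par x h, hx] at h2
      exact h2.trans h1
    · have := step x (by omega)
      rwa [hs.par_pendant x h, hx] at this

theorem IsLobsterShape.lobe_adj (hs : IsLobsterShape p.length p.getVert idx lvl par)
    (hadj : ∀ x y, G.Adj x y ↔ x ≠ a ∧ par x = y ∨ y ≠ a ∧ par y = x) {i : ℕ}
    (hi : i ≤ p.length) (x y : V) :
    (lobe p i).Adj x y ↔ idx x = i ∧ idx y = i ∧
      (lvl x ≠ 0 ∧ par x = y ∨ lvl y ≠ 0 ∧ par y = x) := by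
  simp only [lobe, Subgraph.induce_adj, Set.mem_ofPred_eq, hs.reachable_iff hadj hi,
    Subgraph.top_adj]
  constructor
  · rintro ⟨h1, h2, h3⟩
    exact ⟨h1, h2, (hs.adj_iff hadj (h1.trans h2.symm)).1 h3⟩
  · rintro ⟨h1, h2, h3⟩
    exact ⟨h1, h2, (hs.adj_iff hadj (h1.trans h2.symm)).2 h3⟩

/-- A branch has a leaf as a second neighbour, so it is not pendant; this is the role of `hpos`. -/
theorem IsLobsterShape.mem_pendants_iff [Fintype V]
    (hs : IsLobsterShape p.length p.getVert idx lvl par)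
    (hadj : ∀ x y, G.Adj x y ↔ x ≠ a ∧ par x = y ∨ y ≠ a ∧ par y = x)
    (hpos : ∀ w, lvl w = 1 → 0 < leafCount lvl par w) {i : ℕ}
    (hi : i ≤ p.length) (x : V) :
    x ∈ pendants p i ↔ idx x = i ∧ lvl x = 3 := by
  have hvi := hs.idx_spine i hi
  have hvl := hs.lvl_spine i hi
  simp only [pendants, Set.mem_ofPred_eq, Set.ext_iff, Subgraph.mem_neighborSet,
    hs.lobe_adj hadj hi, Set.mem_singleton_iff]
  constructor
  · intro h
    obtain ⟨h1, -, h2⟩ := (h (p.getVert i)).2 rfl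
    refine ⟨h1, ?_⟩
    rcases h2 with ⟨h2, h3⟩ | ⟨h2, -⟩
    · have hle := hs.lvl_le x
      by_contra h4
      have h5 : lvl x = 1 ∨ lvl x = 2 := by omega
      rcases h5 with h5 | h5
      · obtain ⟨y, hy, hyx⟩ := exists_leaf (hpos x h5)
        have := (h y).1 ⟨h1, by rw [← hs.idx_par y hy, hyx, h1], Or.inr ⟨by omega, hyx⟩⟩
        rw [this] at hy
        omega
      · have := hs.lvl_par x h5
        rw [h3] at this
        omega
    · exact absurd hvl h2
  · rintro ⟨h1, h2⟩ y
    have hp := hs.par_pendant x h2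
    rw [h1] at hp
    constructor
    · rintro ⟨-, h3, h4⟩
      rcases h4 with ⟨-, h4⟩ | ⟨h4, h5⟩
      · rw [← h4, hp]
      · exfalso
        have hle := hs.lvl_le y
        have hy : lvl y = 1 ∨ lvl y = 2 ∨ lvl y = 3 := by omega
        rcases hy with hy | hy | hy
        · have := hs.lvl_par_eq_zero hy
          rw [h5] at this
          omega
        · have := hs.lvl_par y hy
          rw [h5] at this
          omega
        · have := hs.par_pendant y hy
          rw [h5, h3] at this
          rw [this] at h2
          omega
    · rintro rfl
      exact ⟨h1, hvi, Or.inl ⟨by omega, hp⟩⟩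

theorem IsLobsterShape.mem_reducedLobe_iff [Fintype V]
    (hs : IsLobsterShape p.length p.getVert idx lvl par)
    (hadj : ∀ x y, G.Adj x y ↔ x ≠ a ∧ par x = y ∨ y ≠ a ∧ par y = x)
    (hpos : ∀ w, lvl w = 1 → 0 < leafCount lvl par w) {i : ℕ}
    (hi : i ≤ p.length) (x : V) :
    x ∈ (reducedLobe p i).verts ↔ idx x = i ∧ lvl x ≠ 3 := by
  simp only [reducedLobe, Subgraph.deleteVerts_verts, Set.mem_sdiff,
    hs.mem_pendants_iff hadj hpos hi]
  simp only [lobe, Subgraph.induce_verts, Set.mem_ofPred_eq, hs.reachable_iff hadj hi]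
  tauto

theorem IsLobsterShape.reducedLobe_adj [Fintype V]
    (hs : IsLobsterShape p.length p.getVert idx lvl par)
    (hadj : ∀ x y, G.Adj x y ↔ x ≠ a ∧ par x = y ∨ y ≠ a ∧ par y = x)
    (hpos : ∀ w, lvl w = 1 → 0 < leafCount lvl par w) {i : ℕ}
    (hi : i ≤ p.length) (x y : V) :
    (reducedLobe p i).Adj x y ↔ (idx x = i ∧ lvl x ≠ 3) ∧ (idx y = i ∧ lvl y ≠ 3) ∧
      (lvl x ≠ 0 ∧ par x = y ∨ lvl y ≠ 0 ∧ par y = x) := by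
  rw [← hs.mem_reducedLobe_iff hadj hpos hi, ← hs.mem_reducedLobe_iff hadj hpos hi]
  have hx := hs.mem_reducedLobe_iff hadj hpos hi x
  have hy := hs.mem_reducedLobe_iff hadj hpos hi y
  have h1 := hs.lobe_adj hadj hi x y
  simp only [reducedLobe, Subgraph.deleteVerts_verts, Set.mem_sdiff] at hx hy
  simp only [reducedLobe, Subgraph.deleteVerts_adj, Subgraph.deleteVerts_verts, Set.mem_sdiff]
  tauto

theorem IsLobsterShape.neighborSet_reducedLobe [Fintype V]
    (hs : IsLobsterShape p.length p.getVert idx lvl par)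
    (hadj : ∀ x y, G.Adj x y ↔ x ≠ a ∧ par x = y ∨ y ≠ a ∧ par y = x)
    (hpos : ∀ w, lvl w = 1 → 0 < leafCount lvl par w) {i : ℕ} (hi : i ≤ p.length) :
    (reducedLobe p i).neighborSet (p.getVert i) = branches idx lvl i := by
  ext x
  rw [Subgraph.mem_neighborSet, hs.reducedLobe_adj hadj hpos hi, Finset.mem_coe, mem_branches]
  have hvl := hs.lvl_spine i hi
  have hle := hs.lvl_le x
  constructor
  · rintro ⟨-, ⟨h1, h2⟩, ⟨h3, -⟩ | ⟨h3, h4⟩⟩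
    · exact absurd hvl h3
    · refine ⟨h1, ?_⟩
      by_contra h5
      have := hs.lvl_par x (by omega)
      rw [h4] at this
      omega
  · rintro ⟨h1, h2⟩
    exact ⟨⟨hs.idx_spine i hi, by omega⟩, ⟨h1, by omega⟩,
      Or.inr ⟨by omega, by rw [hs.par_branch x h2, h1]⟩⟩

theorem IsLobsterShape.exists_isLobeIso [Fintype V]
    (hs : IsLobsterShape p.length p.getVert idx lvl par)
    (hadj : ∀ x y, G.Adj x y ↔ x ≠ a ∧ par x = y ∨ y ≠ a ∧ par y = x)
    (hpos : ∀ w, lvl w = 1 → 0 < leafCount lvl par w) {i j : ℕ} (hi : i ≤ p.length)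
    (hj : j ≤ p.length) (φ : (reducedLobe p i).coe ≃g (reducedLobe p j).coe) :
    ∃ σ τ, IsLobeIso idx lvl par i j σ τ ∧ IsLobeIso idx lvl par j i τ σ := by
  classical
  -- The isomorphism is extended by the identity outside the reduced lobe, where no condition is
  -- imposed.
  have key : ∀ {i j : ℕ}, i ≤ p.length → j ≤ p.length →
      ∀ φ : (reducedLobe p i).coe ≃g (reducedLobe p j).coe,
      IsLobeIso idx lvl par i j
        (fun x => if h : x ∈ (reducedLobe p i).verts then φ ⟨x, h⟩ else x)
        (fun x => if h : x ∈ (reducedLobe p j).verts then φ.symm ⟨x, h⟩ else x) := by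
    intro i j hi hj φ
    have mi := hs.mem_reducedLobe_iff hadj hpos hi
    have mj := hs.mem_reducedLobe_iff hadj hpos hj
    constructor
    · intro x h1 h2
      have hx := (mi x).2 ⟨h1, h2⟩
      simp only [dif_pos hx]
      exact (mj _).1 (φ ⟨x, hx⟩).2
    · intro x h1 h2
      have hx := (mi x).2 ⟨h1, h2⟩
      simp [hx]
    · intro x h1 h2 h3
      have hx := (mi x).2 ⟨h1, h3⟩
      have hle := hs.lvl_le x
      have hpx : idx (par x) = i ∧ lvl (par x) ≠ 3 := by
        have h4 : lvl x = 1 ∨ lvl x = 2 := by omega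
        rcases h4 with h4 | h4
        · rw [hs.lvl_par_eq_zero h4, hs.par_branch x h4, hs.idx_spine _ (hs.idx_le x), h1]
          omega
        · rw [hs.lvl_par x h4, hs.idx_par x h4, h1]
          omega
      have hp := (mi _).2 hpx
      have h5 : (reducedLobe p i).coe.Adj ⟨x, hx⟩ ⟨par x, hp⟩ := by
        rw [Subgraph.coe_adj]
        exact (hs.reducedLobe_adj hadj hpos hi _ _).2 ⟨⟨h1, h3⟩, hpx, Or.inl ⟨h2, rfl⟩⟩
      have h6 := φ.map_adj_iff.2 h5
      rw [Subgraph.coe_adj, hs.reducedLobe_adj hadj hpos hj] at h6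
      simp only [dif_pos hx, dif_pos hp]
      exact h6.2.2
  exact ⟨_, _, key hi hj φ, key hj hi φ.symm⟩

end LobsterGraph

/-! ### Assembling the graceful labeling. -/

theorem theorem4p1 {V : Type*} [Finite V] (G : SimpleGraph V) {a b : V} (p : G.Walk a b)
    (hL : LobsterGraph.IsLobsterWithSpine G p)
    (hsim : LobsterGraph.PairwiseSimilar p)
    (hodd : ∀ i, i ≤ p.length → LobsterGraph.EssentiallyOdd p i) :
    LobsterGraph.IsGraceful G := by
  classical
  have := Fintype.ofFinite V
  obtain ⟨idx, lvl, par, hs, hadj, hpos⟩ := hL.exists_shape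
  have hodd' : ∀ i, i ≤ p.length → Odd (LobsterGraph.branches idx lvl i).card := by
    intro i hi
    have := hodd i hi
    rwa [LobsterGraph.EssentiallyOdd, hs.neighborSet_reducedLobe hadj hpos hi,
      Set.ncard_coe_finset] at this
  obtain ⟨f, hf⟩ := hs.exists_isTailLabeling fun i hi he => by
    obtain ⟨K, t, ht, hK⟩ :=
      LobsterGraph.exists_isBranchNumbering (idx := idx) (lvl := lvl) (par := par) i
    refine ⟨_, K, hodd' i hi, ?_, hK, hs.exists_isLobeCoding hi ht, ?_⟩
    · intro s hs'
      rw [← Finset.mem_range, ← LobsterGraph.image_eq_range ht.lt ht.inj] at hs'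
      obtain ⟨w, hw, rfl⟩ := Finset.mem_image.1 hs'
      rw [← ht.leafCount_eq w hw]
      exact hpos w (LobsterGraph.mem_branches.1 hw).2
    -- Transporting the numbering gives the partner lobe the same `d` and `K`, so one lobe labeling
    -- serves both.
    · intro hi'
      obtain ⟨φ⟩ := hsim i he hi'
      obtain ⟨σ, τ, h1, h2⟩ := hs.exists_isLobeIso hadj hpos hi hi' φ
      obtain ⟨t', ht'⟩ := LobsterGraph.IsBranchNumbering.transport h1 h2 hs hi hi' hpos
        (hodd' i hi) (hodd' _ hi') ht
      exact hs.exists_isLobeCoding hi' ht'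
  have hcast : ∀ x, ((f x).toNat : ℤ) = f x := fun x =>
    Int.toNat_of_nonneg (hf.nonneg x (Nat.zero_le _))
  have hcard : G.edgeSet.ncard + 1 = Fintype.card V := by
    rw [← hL.isTree.card_edgeFinset, Set.ncard_eq_toFinset_card', SimpleGraph.edgeFinset]
  refine ⟨fun x => (f x).toNat, ?_, ?_, ?_⟩
  · intro x
    have h1 := hf.lt_card x (Nat.zero_le _)
    have h2 := hcast x
    simp only [Nat.zero_le, Finset.filter_true, Finset.card_univ] at h1
    omega
  · intro x y hxy
    refine hf.inj x y (Nat.zero_le _) (Nat.zero_le _) ?_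
    rw [← hcast x, ← hcast y]
    exact congrArg Nat.cast hxy
  · intro x y z w hxy hzw h
    simp only [hcast] at h
    have key : ∀ x y, G.Adj x y → ∃ u, u ≠ p.getVert 0 ∧ s(x, y) = s(u, par u) ∧
        |f x - f y| = |f u - f (par u)| := by
      intro x y hxy
      rw [p.getVert_zero]
      rcases (hadj x y).1 hxy with ⟨h1, rfl⟩ | ⟨h1, rfl⟩
      · exact ⟨x, h1, rfl, rfl⟩
      · exact ⟨y, h1, Sym2.eq_swap, abs_sub_comm _ _⟩
    obtain ⟨u, hu, e1, e2⟩ := key x y hxy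
    obtain ⟨u', hu', e1', e2'⟩ := key z w hzw
    rw [e2, e2'] at h
    rw [e1, e1', hf.edge_inj u u' (Nat.zero_le _) (Nat.zero_le _) hu hu' h]
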